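/- **Setting.** Let $\Omega\subset\mathbb R^3$ be open, bounded and convex, and let $\Sigma$ be a generalized cylinder with rectilinear centreline $\Lambda=\{\lambda(s):s\in(0,S)\}$ ($s$ is arc length) and elliptic sections $\Sigma(s)$ orthogonal to $\Lambda$, with semi-axes that are $C^1$ in $s$ and non-degenerate for $s\in[0,S]$. The closed sections lie in $\Omega$ for $0<s<S$ and on $\partial\Omega$ for $s=0,S$. Let $\Gamma$ be the lateral surface of $\Sigma$, $\Gamma(s)=\partial\Sigma(s)$, and let $|\Gamma(s)|$, $|\Sigma(s)|$ be the perimeter and the area of the section. Put $\hat V=H^1_0(\Lambda)$, and let $$\mathcal H^\Gamma=\{w\in H^{1/2}(\Gamma):\ w|_{\Gamma(s)}=\hat v(s)\ \text{for some }\hat v\in\hat V\}$$ with the Sobolev–Slobodeckij inner product of $H^{1/2}(\Gamma)$. Let $\mathcal E_\Gamma:\hat V\to\mathcal H^\Gamma$, $(\mathcal E_\Gamma\hat v)|_{\Gamma(s)}=\hat v(s)$, be the extension operator, and let $V=\{v\in H^1_0(\Omega): v|_\Gamma\in\mathcal H^\Gamma\}$, with trace operator $\gamma_\Gamma:V\to\mathcal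 H^\Gamma$. For $v\in V$ let $\check v\in\hat V$ be the function with $\gamma_\Gamma v=\mathcal E_\Gamma\check v$; $V$ is normed by $\|v\|_V^2=\|v\|_{H^1(\Omega)}^2+\|\check v\|_{H^1(\Lambda)}^2$. Let $\Theta_{\hat V}:\hat V\to\hat V'$ be the Riesz isomorphism and $\Theta_{\mathcal H^\Gamma}:\mathcal H^\Gamma\to{\mathcal H^\Gamma}'$, $w\mapsto(w,\cdot)_{\mathcal H^\Gamma}$, the Riesz map. Let $\boldsymbol K\in L^\infty(\Omega;\mathbb R^{3\times3})$ and $\tilde K\in L^\infty(\Lambda)$ be uniformly positive, $f\in L^2(\Omega)$, $\alpha,\hat\alpha>0$, and let $g$ be a function on $\Sigma$ whose section means $\bar{\bar g}(s)=\frac1{|\Sigma(s)|}\int_{\Sigma(s)}g\,d\sigma$ are defined for a.e. $s$ and lie in $L^2(\Lambda)$. For $u,v\in V$, $\hat u,\hat v,\hat\psi\in\hat V$, $\bar\phi\in\hat V'$ define $A:V\to V'$, $\hat A:\hat V\to\hat V'$, $B:\hat V'\to V'$, $\hat B:\hat V'\to\hat V'$, $C:\hat V\to V'$, $\hat C:\hat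 V\to\hat V'$, $F\in V'$, $G\in\hat V'$ by $$\langle Au,v\rangle=\int_\Omega \boldsymbol K\nabla u\cdot\nabla v+\alpha\int_0^S|\Gamma|\check u\,\check v\,ds,\qquad \langle\hat A\hat u,\hat v\rangle=\int_0^S\tilde K|\Sigma|\hat u'\hat v'\,ds+\hat\alpha\int_0^S|\Gamma|\hat u\,\hat v\,ds,$$ $$\langle B\bar\phi,v\rangle=\langle\bar\phi,|\Gamma|\check v\rangle,\quad \langle\hat B\bar\phi,\hat v\rangle=\langle\bar\phi,|\Gamma|\hat v\rangle,\quad \langle C\hat\psi,v\rangle=\alpha\int_0^S|\Gamma|\hat\psi\,\check v\,ds,\quad \langle\hat C\hat\psi,\hat v\rangle=\hat\alpha\int_0^S|\Gamma|\hat\psi\,\hat v\,ds,$$ $$F(v)=\int_\Omega fv,\qquad G(\hat v)=\int_0^S|\Sigma|\,\bar{\bar g}\,\hat v\,ds,$$ and let $^*$ denote adjoints, with $\hat V''=\hat V$, so that $A^*:V\to V'$, $\hat A^*:\hat V\to\hat V'$, $B^*:V\to\hat V$, $\hat B^*:\hat V\to\hat V$, $C^*:V\to\hat V'$, $\hat C^*:\hat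 V\to\hat V'$, $\gamma_\Gamma^*:{\mathcal H^\Gamma}'\to V'$ and $\mathcal E_\Gamma^*:{\mathcal H^\Gamma}'\to\hat V'$. Consider the problem of minimizing $$J(\bar\phi,\hat\psi)=\tfrac12\left(\|\gamma_\Gamma u-\mathcal E_\Gamma\hat\psi\|^2_{\mathcal H^\Gamma}+\|\mathcal E_\Gamma\hat u-\mathcal E_\Gamma\hat\psi\|^2_{\mathcal H^\Gamma}\right)$$ over the controls $(\bar\phi,\hat\psi)\in\hat V'\times\hat V$ that have a state $(u,\hat u)=(u(\bar\phi,\hat\psi),\hat u(\bar\phi,\hat\psi))\in V\times\hat V$, that is, a solution of $$Au-B\bar\phi-C\hat\psi=F,\qquad \hat A\hat u+\hat B\bar\phi-\hat C\hat\psi=G .$$ The admissible set is the set of quadruples $(\bar\phi,\hat\psi,u,\hat u)$ that satisfy these equations. The adjoint equations at such a quadruple are $$A^*p=\gamma_\Gamma^*\Theta_{\mathcal H^\Gamma}(\gamma_\Gamma u-\mathcal E_\Gamma\hat\psi),\qquad \hat A^*\hat p=\mathcal E_\Gamma^*\Theta_{\mathcal H^\Gamma}(\mathcal E_\Gamma\hat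 u-\mathcal E_\Gamma\hat\psi),\qquad p\in V,\ \hat p\in\hat V. \tag{1}$$ **Proposition.** 1. The state $(u,\hat u)$ is unique when it exists. In (1), $p$ is unique when it exists, and $\hat p$ exists and is unique. 2. At every admissible quadruple at which (1) has a solution $(p,\hat p)$, the functional, as a function on the admissible set, is Fréchet differentiable relative to that set, with derivative $$(\delta\bar\phi,\delta\hat\psi,\delta u,\delta\hat u)\mapsto\left(\Theta_{\hat V}(B^*p-\hat B^*\hat p),\delta\bar\phi\right)_{\hat V'}+\left(\Theta_{\hat V}^{-1}\big(C^*p+\hat C^*\hat p-\mathcal E_\Gamma^*\Theta_{\mathcal H^\Gamma}(\gamma_\Gamma u+\mathcal E_\Gamma\hat u-2\mathcal E_\Gamma\hat\psi)\big),\delta\hat\psi\right)_{\hat V}.$$ 3. An optimal control exists. For every optimal control $(\bar\phi,\hat\psi)$, with state $(u,\hat u)$, each of the equations (1) has exactly one solution, and $$\Theta_{\hat V}(B^*p-\hat B^*\hat p)=0,$$ $$\Theta_{\hat V}^{-1}\big(C^*p+\hat C^*\hat p-\mathcal E_\Gamma^*\Theta_{\mathcal H^\Gamma}(\gamma_\Gamma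 u+\mathcal E_\Gamma\hat u-2\mathcal E_\Gamma\hat\psi)\big)=0 .$$ -/

import Mathlib

open MeasureTheory Set Filter Topology
open scoped ENNReal RealInnerProductSpace Gradient

noncomputable section

namespace Coupled3D1D

/-! ### Sobolev spaces -/

/-- The ambient space `L²(U) × L²(U; E)` of `H¹(U)`: a weakly differentiable function `v` is
represented by the pair `(v, ∇v)`; the inner product is `(v, w)_{L²} + (∇v, ∇w)_{L²}`. -/
abbrev SobolevPair {E : Type*} [NormedAddCommGroup E] [InnerProductSpace ℝ E] [MeasureSpace E]
    (U : Set E) : Type _ :=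
  WithLp 2 (Lp ℝ 2 (volume.restrict U) × Lp E 2 (volume.restrict U))

/-- Test functions on `U`: continuously differentiable with compact support in `U`. -/
def IsTest {E : Type*} [NormedAddCommGroup E] [NormedSpace ℝ E] (U : Set E) (φ : E → ℝ) : Prop :=
  ContDiff ℝ 1 φ ∧ HasCompactSupport φ ∧ tsupport φ ⊆ U

theorem IsTest.zero {E : Type*} [NormedAddCommGroup E] [NormedSpace ℝ E] (U : Set E) :
    IsTest U (fun _ : E => (0 : ℝ)) := by
  refine ⟨contDiff_const, HasCompactSupport.zero, ?_⟩
  have : tsupport (fun _ : E => (0 : ℝ)) = ∅ := by simp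
  simp [this]

theorem IsTest.add {E : Type*} [NormedAddCommGroup E] [NormedSpace ℝ E] {U : Set E}
    {φ η : E → ℝ} (hφ : IsTest U φ) (hη : IsTest U η) : IsTest U (fun x => φ x + η x) :=
  ⟨hφ.1.add hη.1, hφ.2.1.add hη.2.1, (tsupport_add φ η).trans (union_subset hφ.2.2 hη.2.2)⟩

theorem IsTest.smul {E : Type*} [NormedAddCommGroup E] [NormedSpace ℝ E] {U : Set E}
    (c : ℝ) {φ : E → ℝ} (hφ : IsTest U φ) : IsTest U (fun x => c * φ x) :=
  ⟨contDiff_const.mul hφ.1, hφ.2.1.mul_left,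
    (tsupport_mul_subset_right (f := fun _ => c) (g := φ)).trans hφ.2.2⟩

theorem IsTest.gradient_add {E : Type*} [NormedAddCommGroup E] [InnerProductSpace ℝ E]
    [CompleteSpace E] {U : Set E} {φ η : E → ℝ} (hφ : IsTest U φ) (hη : IsTest U η) (x : E) :
    ∇ (fun x => φ x + η x) x = ∇ φ x + ∇ η x := by
  have h1 : DifferentiableAt ℝ φ x := hφ.1.differentiable one_ne_zero x
  have h2 : DifferentiableAt ℝ η x := hη.1.differentiable one_ne_zero x
  simp only [gradient]
  rw [fderiv_fun_add h1 h2, map_add]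

theorem IsTest.gradient_smul {E : Type*} [NormedAddCommGroup E] [InnerProductSpace ℝ E]
    [CompleteSpace E] {U : Set E} (c : ℝ) {φ : E → ℝ} (hφ : IsTest U φ) (x : E) :
    ∇ (fun x => c * φ x) x = c • ∇ φ x := by
  have h1 : DifferentiableAt ℝ φ x := hφ.1.differentiable one_ne_zero x
  simp only [gradient]
  rw [fderiv_const_mul h1, map_smulₛₗ]
  simp

/-- The pairs `(φ, ∇φ)` with `φ` a test function on `U`. -/
def testPairs {E : Type*} [NormedAddCommGroup E] [InnerProductSpace ℝ E] [CompleteSpace E]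
    [MeasureSpace E] (U : Set E) : Submodule ℝ (SobolevPair U) where
  carrier := {p | ∃ φ : E → ℝ, IsTest U φ ∧ p.fst =ᵐ[volume.restrict U] φ ∧
    p.snd =ᵐ[volume.restrict U] ∇ φ}
  zero_mem' := by
    refine ⟨fun _ => 0, IsTest.zero U, Lp.coeFn_zero _ _ _, ?_⟩
    have : ∇ (fun _ : E => (0 : ℝ)) = fun _ => 0 := by
      funext x
      simp [gradient]
    rw [this]
    exact Lp.coeFn_zero _ _ _
  add_mem' := by
    rintro p r ⟨φ, hφ, h1, h2⟩ ⟨η, hη, h3, h4⟩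
    refine ⟨_, hφ.add hη, ?_, ?_⟩
    · filter_upwards [h1, h3, Lp.coeFn_add p.fst r.fst] with x a b c
      rw [WithLp.add_fst, c, Pi.add_apply, a, b]
    · filter_upwards [h2, h4, Lp.coeFn_add p.snd r.snd] with x a b c
      rw [WithLp.add_snd, c, Pi.add_apply, a, b, hφ.gradient_add hη]
  smul_mem' := by
    rintro c p ⟨φ, hφ, h1, h2⟩
    refine ⟨_, hφ.smul c, ?_, ?_⟩
    · filter_upwards [h1, Lp.coeFn_smul c p.fst] with x a d
      rw [WithLp.smul_fst, d, Pi.smul_apply, a, smul_eq_mul]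
    · filter_upwards [h2, Lp.coeFn_smul c p.snd] with x a d
      rw [WithLp.smul_snd, d, Pi.smul_apply, a, hφ.gradient_smul]

/-- `H¹₀(U)`: the closure of the test functions in `H¹(U)`. -/
abbrev H10 {E : Type*} [NormedAddCommGroup E] [InnerProductSpace ℝ E] [CompleteSpace E]
    [MeasureSpace E] (U : Set E) : Submodule ℝ (SobolevPair U) :=
  (testPairs U).topologicalClosure

/-- Three-dimensional Euclidean space. -/
abbrev E3 : Type := EuclideanSpace ℝ (Fin 3)

/-! ### Geometry -/

/-- A generalized cylinder with rectilinear centreline `λ(s) = origin + s • dir`, `0 < s < S`, and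
elliptic cross-sections orthogonal to the centreline: the section at `s` is the ellipse centred at
`λ(s)` whose (orthogonal) semi-axes are the vectors `semi₁ s` and `semi₂ s`. -/
structure Cylinder where
  S : ℝ
  S_pos : 0 < S
  origin : E3
  dir : E3
  dir_norm : ‖dir‖ = 1
  semi₁ : ℝ → E3
  semi₂ : ℝ → E3
  smooth₁ : ContDiff ℝ 1 semi₁
  smooth₂ : ContDiff ℝ 1 semi₂
  orth₁ : ∀ s ∈ Icc 0 S, ⟪semi₁ s, dir⟫ = 0
  orth₂ : ∀ s ∈ Icc 0 S, ⟪semi₂ s, dir⟫ = 0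
  orth₁₂ : ∀ s ∈ Icc 0 S, ⟪semi₁ s, semi₂ s⟫ = 0
  semi₁_ne : ∀ s ∈ Icc 0 S, semi₁ s ≠ 0
  semi₂_ne : ∀ s ∈ Icc 0 S, semi₂ s ≠ 0

namespace Cylinder

/-- The point of the section at `s` with elliptic polar coordinates `(r, θ)`. -/
def point (c : Cylinder) (r θ s : ℝ) : E3 :=
  c.origin + s • c.dir + r • (Real.cos θ • c.semi₁ s + Real.sin θ • c.semi₂ s)

/-- The centreline `Λ`, identified with `(0, S)` through arc length. -/
abbrev line (c : Cylinder) : Set ℝ := Ioo 0 c.S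

/-- The parametrization `(θ, s) ↦ X(θ, s)` of the lateral surface `Γ`. -/
def lateral (c : Cylinder) (z : ℝ × ℝ) : E3 := c.point 1 z.1 z.2

/-- The parameter domain of the lateral surface. -/
def params (c : Cylinder) : Set (ℝ × ℝ) := Ioo 0 (2 * Real.pi) ×ˢ Ioo 0 c.S

/-- The partial derivative `∂X/∂θ`. -/
def dTheta (c : Cylinder) (z : ℝ × ℝ) : E3 :=
  -Real.sin z.1 • c.semi₁ z.2 + Real.cos z.1 • c.semi₂ z.2

/-- The partial derivative `∂X/∂s`. -/
def dS (c : Cylinder) (z : ℝ × ℝ) : E3 :=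
  c.dir + (Real.cos z.1 • deriv c.semi₁ z.2 + Real.sin z.1 • deriv c.semi₂ z.2)

/-- The area element `√(|∂_θ X|² |∂_s X|² - ⟨∂_θ X, ∂_s X⟩²)` of the lateral surface. -/
def areaElement (c : Cylinder) (z : ℝ × ℝ) : ℝ :=
  √(‖c.dTheta z‖ ^ 2 * ‖c.dS z‖ ^ 2 - ⟪c.dTheta z, c.dS z⟫ ^ 2)

/-- The surface measure of the lateral surface `Γ`, as a measure on `ℝ³`. -/
def surface (c : Cylinder) : Measure E3 :=
  ((volume.restrict c.params).withDensity fun z => ENNReal.ofReal (c.areaElement z)).map c.lateral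

/-- The axial coordinate `s` of a point of `ℝ³`. -/
def axial (c : Cylinder) (x : E3) : ℝ := ⟪x - c.origin, c.dir⟫

/-- The perimeter `|Γ(s)|` of the section at `s`. -/
def perimeter (c : Cylinder) (s : ℝ) : ℝ := ∫ θ in 0..(2 * Real.pi), ‖c.dTheta (θ, s)‖

/-- The area `|Σ(s)|` of the section at `s`. -/
def sectionArea (c : Cylinder) (s : ℝ) : ℝ := Real.pi * ‖c.semi₁ s‖ * ‖c.semi₂ s‖

/-- The mean value of `g` over the section at `s`, computed in elliptic polar coordinates
(whose Jacobian is `r ‖semi₁ s‖ ‖semi₂ s‖`). -/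
def sectionMean (c : Cylinder) (g : E3 → ℝ) (s : ℝ) : ℝ :=
  (1 / c.sectionArea s) * ∫ z in Ioo (0 : ℝ) 1 ×ˢ Ioo 0 (2 * Real.pi),
    g (c.point z.1 z.2 s) * (z.1 * ‖c.semi₁ s‖ * ‖c.semi₂ s‖)

/-! #### Elementary facts on the geometry -/

theorem continuous_lateral (c : Cylinder) : Continuous c.lateral := by
  have h1 := c.smooth₁.continuous
  have h2 := c.smooth₂.continuous
  unfold lateral point
  fun_prop

theorem continuous_dTheta (c : Cylinder) : Continuous c.dTheta := by
  have h1 := c.smooth₁.continuous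
  have h2 := c.smooth₂.continuous
  unfold dTheta
  fun_prop

theorem continuous_dS (c : Cylinder) : Continuous c.dS := by
  have h1 := c.smooth₁.continuous_deriv le_rfl
  have h2 := c.smooth₂.continuous_deriv le_rfl
  unfold dS
  fun_prop

theorem continuous_areaElement (c : Cylinder) : Continuous c.areaElement := by
  have h1 := c.continuous_dTheta
  have h2 := c.continuous_dS
  unfold areaElement
  fun_prop

theorem continuous_axial (c : Cylinder) : Continuous c.axial := by
  unfold axial
  fun_prop

theorem continuous_sectionArea (c : Cylinder) : Continuous c.sectionArea := by
  have h1 := c.smooth₁.continuous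
  have h2 := c.smooth₂.continuous
  unfold sectionArea
  fun_prop

theorem continuous_perimeter (c : Cylinder) : Continuous c.perimeter := by
  have h := c.continuous_dTheta
  unfold perimeter
  apply intervalIntegral.continuous_parametric_intervalIntegral_of_continuous'
  fun_prop

theorem axial_lateral (c : Cylinder) {z : ℝ × ℝ} (hz : z.2 ∈ Icc 0 c.S) :
    c.axial (c.lateral z) = z.2 := by
  have h : c.lateral z - c.origin = z.2 • c.dir +
      (Real.cos z.1 • c.semi₁ z.2 + Real.sin z.1 • c.semi₂ z.2) := by
    simp only [lateral, point, one_smul]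
    abel
  rw [axial, h, inner_add_left, inner_add_left, inner_smul_left, inner_smul_left, inner_smul_left,
    c.orth₁ _ hz, c.orth₂ _ hz, real_inner_self_eq_norm_sq, c.dir_norm]
  simp

theorem exists_areaElement_le (c : Cylinder) :
    ∃ C : ℝ, 0 ≤ C ∧ ∀ z ∈ c.params, c.areaElement z ≤ C := by
  have hK : IsCompact (Icc (0 : ℝ) (2 * Real.pi) ×ˢ Icc 0 c.S) := isCompact_Icc.prod isCompact_Icc
  obtain ⟨C, hC⟩ := hK.exists_bound_of_continuousOn c.continuous_areaElement.continuousOn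
  refine ⟨max C 0, le_max_right _ _, fun z hz => ?_⟩
  have hz' : z ∈ Icc (0 : ℝ) (2 * Real.pi) ×ˢ Icc 0 c.S :=
    ⟨Ioo_subset_Icc_self hz.1, Ioo_subset_Icc_self hz.2⟩
  exact ((le_abs_self _).trans (hC z hz')).trans (le_max_left _ _)

/-- The density measure is dominated by a multiple of Lebesgue measure. -/
theorem exists_density_le (c : Cylinder) : ∃ C : ℝ≥0∞, C ≠ ∞ ∧
    ((volume.restrict c.params).withDensity fun z => ENNReal.ofReal (c.areaElement z)) ≤
      C • volume.restrict c.params := by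
  obtain ⟨C, -, hC⟩ := c.exists_areaElement_le
  refine ⟨ENNReal.ofReal C, ENNReal.ofReal_ne_top, ?_⟩
  rw [← withDensity_const]
  apply withDensity_mono
  have hm : MeasurableSet c.params := measurableSet_Ioo.prod measurableSet_Ioo
  filter_upwards [ae_restrict_mem hm] with z hz
  exact ENNReal.ofReal_le_ofReal (hC z hz)

theorem volume_params_lt_top (c : Cylinder) : volume c.params < ∞ := by
  have : c.params ⊆ Icc (0 : ℝ) (2 * Real.pi) ×ˢ Icc 0 c.S :=
    prod_mono Ioo_subset_Icc_self Ioo_subset_Icc_self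
  exact (measure_mono this).trans_lt (isCompact_Icc.prod isCompact_Icc).measure_lt_top

instance isFiniteMeasure_surface (c : Cylinder) : IsFiniteMeasure c.surface := by
  obtain ⟨C, hC, hle⟩ := c.exists_density_le
  constructor
  rw [surface, Measure.map_apply c.continuous_lateral.measurable MeasurableSet.univ, preimage_univ]
  refine (hle univ).trans_lt ?_
  rw [Measure.smul_apply, smul_eq_mul, Measure.restrict_apply_univ]
  exact ENNReal.mul_lt_top hC.lt_top c.volume_params_lt_top

/-- The axial coordinate pushes the surface measure to a measure with bounded density. -/
theorem exists_map_axial_le (c : Cylinder) : ∃ C : ℝ≥0∞, C ≠ ∞ ∧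
    c.surface.map c.axial ≤ C • volume.restrict c.line := by
  obtain ⟨C, hC, hle⟩ := c.exists_density_le
  refine ⟨C * ENNReal.ofReal (2 * Real.pi), ENNReal.mul_ne_top hC ENNReal.ofReal_ne_top, ?_⟩
  have hm : MeasurableSet c.params := measurableSet_Ioo.prod measurableSet_Ioo
  rw [surface, Measure.map_map c.continuous_axial.measurable c.continuous_lateral.measurable]
  have hmeas := c.continuous_axial.measurable.comp c.continuous_lateral.measurable
  refine (Measure.map_mono hle hmeas).trans ?_
  rw [Measure.map_smul]
  have hae : (c.axial ∘ c.lateral) =ᵐ[volume.restrict c.params] Prod.snd := by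
    filter_upwards [ae_restrict_mem hm] with z hz
    exact c.axial_lateral (Ioo_subset_Icc_self hz.2)
  rw [Measure.map_congr hae, params, Measure.volume_eq_prod, ← Measure.prod_restrict,
    Measure.map_snd_prod, Measure.restrict_apply_univ, Real.volume_Ioo, sub_zero, smul_smul]

end Cylinder

/-! ### Multiplication operators -/

/-- Multiplication `u ↦ k u` of an `L²` field by an essentially bounded operator field. -/
def tensorMul {α : Type*} [MeasurableSpace α] {μ : Measure α} {F : Type*} [NormedAddCommGroup F]
    [NormedSpace ℝ F] (k : α → F →L[ℝ] F) (hk : MemLp k ∞ μ) : Lp F 2 μ →L[ℝ] Lp F 2 μ :=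
  (ContinuousLinearMap.id ℝ (F →L[ℝ] F)).holderL μ ∞ 2 2 (hk.toLp k)

theorem tensorMul_coe {α : Type*} [MeasurableSpace α] {μ : Measure α} {F : Type*}
    [NormedAddCommGroup F] [NormedSpace ℝ F] (k : α → F →L[ℝ] F) (hk : MemLp k ∞ μ)
    (u : Lp F 2 μ) : tensorMul k hk u =ᵐ[μ] fun x => k x (u x) := by
  have h := (ContinuousLinearMap.id ℝ (F →L[ℝ] F)).coeFn_holder (r := 2) (hk.toLp k) u
  filter_upwards [h, hk.coeFn_toLp] with x h1 h2
  rw [tensorMul, ContinuousLinearMap.holderL_apply_apply, h1, h2]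
  rfl

/-- Multiplication `u ↦ k u` of an `L²` function by an essentially bounded function. -/
def scalarMul {α : Type*} [MeasurableSpace α] {μ : Measure α} (k : α → ℝ) (hk : MemLp k ∞ μ) :
    Lp ℝ 2 μ →L[ℝ] Lp ℝ 2 μ :=
  (ContinuousLinearMap.mul ℝ ℝ).holderL μ ∞ 2 2 (hk.toLp k)

theorem scalarMul_coe {α : Type*} [MeasurableSpace α] {μ : Measure α} (k : α → ℝ)
    (hk : MemLp k ∞ μ) (u : Lp ℝ 2 μ) : scalarMul k hk u =ᵐ[μ] fun x => k x * u x := by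
  have h := (ContinuousLinearMap.mul ℝ ℝ).coeFn_holder (r := 2) (hk.toLp k) u
  filter_upwards [h, hk.coeFn_toLp] with x h1 h2
  rw [scalarMul, ContinuousLinearMap.holderL_apply_apply, h1, h2]
  rfl

/-- The inner product of a real Hilbert space as a bounded bilinear form. -/
def innerForm (H : Type*) [NormedAddCommGroup H] [InnerProductSpace ℝ H] : H →L[ℝ] H →L[ℝ] ℝ :=
  (isBoundedBilinearMap_inner (𝕜 := ℝ) (E := H)).toContinuousLinearMap

theorem innerForm_apply (H : Type*) [NormedAddCommGroup H] [InnerProductSpace ℝ H] (v w : H) :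
    innerForm H v w = ⟪v, w⟫ := rfl

namespace Cylinder

theorem dTheta_ne_zero (c : Cylinder) {s : ℝ} (hs : s ∈ Icc 0 c.S) (θ : ℝ) :
    c.dTheta (θ, s) ≠ 0 := by
  intro h
  have h1 : ⟪c.dTheta (θ, s), c.semi₁ s⟫ = -Real.sin θ * ‖c.semi₁ s‖ ^ 2 := by
    simp only [dTheta]
    rw [inner_add_left, inner_smul_left, inner_smul_left, real_inner_comm,
      real_inner_self_eq_norm_sq, real_inner_comm, c.orth₁₂ s hs]
    simp
  have h2 : ⟪c.dTheta (θ, s), c.semi₂ s⟫ = Real.cos θ * ‖c.semi₂ s‖ ^ 2 := by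
    simp only [dTheta]
    rw [inner_add_left, inner_smul_left, inner_smul_left, c.orth₁₂ s hs,
      real_inner_self_eq_norm_sq]
    simp
  rw [h, inner_zero_left] at h1 h2
  have n1 := norm_ne_zero_iff.2 (c.semi₁_ne s hs)
  have n2 := norm_ne_zero_iff.2 (c.semi₂_ne s hs)
  have e1 : Real.sin θ = 0 := by
    have := h1.symm
    simpa [n1] using this
  have e2 : Real.cos θ = 0 := by
    have := h2.symm
    simpa [n2] using this
  have := Real.sin_sq_add_cos_sq θ
  rw [e1, e2] at this
  norm_num at this

/-- The `s`-derivative of `∂X/∂θ`. -/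
def dThetaS (c : Cylinder) (z : ℝ × ℝ) : E3 :=
  -Real.sin z.1 • deriv c.semi₁ z.2 + Real.cos z.1 • deriv c.semi₂ z.2

theorem continuous_dThetaS (c : Cylinder) : Continuous c.dThetaS := by
  have h1 := c.smooth₁.continuous_deriv le_rfl
  have h2 := c.smooth₂.continuous_deriv le_rfl
  unfold dThetaS
  fun_prop

theorem hasDerivAt_norm_dTheta (c : Cylinder) {s : ℝ} (hs : s ∈ Icc 0 c.S) (θ : ℝ) :
    HasDerivAt (fun s => ‖c.dTheta (θ, s)‖)
      (⟪c.dTheta (θ, s), c.dThetaS (θ, s)⟫ / ‖c.dTheta (θ, s)‖) s := by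
  have h1 : HasDerivAt c.semi₁ (deriv c.semi₁ s) s :=
    (c.smooth₁.differentiable one_ne_zero s).hasDerivAt
  have h2 : HasDerivAt c.semi₂ (deriv c.semi₂ s) s :=
    (c.smooth₂.differentiable one_ne_zero s).hasDerivAt
  have h3 : HasDerivAt (fun s => c.dTheta (θ, s)) (c.dThetaS (θ, s)) s :=
    (h1.const_smul (-Real.sin θ)).add (h2.const_smul (Real.cos θ))
  have h4 := (h3.norm_sq).sqrt (by
    have := norm_ne_zero_iff.2 (c.dTheta_ne_zero hs θ)
    positivity)
  simp only [Real.sqrt_sq (norm_nonneg _)] at h4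
  convert h4 using 1
  rw [mul_div_mul_left _ _ two_ne_zero]

theorem exists_dThetaS_bound (c : Cylinder) : ∃ C : ℝ, 0 ≤ C ∧ ∀ θ, ∀ s ∈ Icc 0 c.S,
    ‖c.dThetaS (θ, s)‖ ≤ C := by
  obtain ⟨C1, h1⟩ := (isCompact_Icc (a := (0 : ℝ)) (b := c.S)).exists_bound_of_continuousOn
    (c.smooth₁.continuous_deriv le_rfl).continuousOn
  obtain ⟨C2, h2⟩ := (isCompact_Icc (a := (0 : ℝ)) (b := c.S)).exists_bound_of_continuousOn
    (c.smooth₂.continuous_deriv le_rfl).continuousOn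
  have h0 : (0 : ℝ) ∈ Icc 0 c.S := ⟨le_rfl, c.S_pos.le⟩
  have p1 := (norm_nonneg _).trans (h1 0 h0)
  have p2 := (norm_nonneg _).trans (h2 0 h0)
  refine ⟨C1 + C2, add_nonneg p1 p2, fun θ s hs => ?_⟩
  refine (norm_add_le _ _).trans ?_
  rw [norm_smul, norm_smul]
  have a1 : ‖-Real.sin θ‖ ≤ 1 := by
    rw [norm_neg]
    exact Real.abs_sin_le_one θ
  have a2 : ‖Real.cos θ‖ ≤ 1 := Real.abs_cos_le_one θ
  have := mul_le_mul a1 (h1 s hs) (norm_nonneg _) zero_le_one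
  have := mul_le_mul a2 (h2 s hs) (norm_nonneg _) zero_le_one
  simp only at *
  linarith

/-- The derivative of the perimeter. -/
def perimeterDeriv (c : Cylinder) (s : ℝ) : ℝ :=
  ∫ θ in 0..(2 * Real.pi), ⟪c.dTheta (θ, s), c.dThetaS (θ, s)⟫ / ‖c.dTheta (θ, s)‖

theorem norm_integrand_le (c : Cylinder) {C : ℝ} {θ s : ℝ} (h : ‖c.dThetaS (θ, s)‖ ≤ C) :
    ‖⟪c.dTheta (θ, s), c.dThetaS (θ, s)⟫ / ‖c.dTheta (θ, s)‖‖ ≤ C := by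
  have hC := (norm_nonneg _).trans h
  rw [norm_div, norm_norm]
  apply div_le_of_le_mul₀ (norm_nonneg _) hC
  refine (norm_inner_le_norm _ _).trans ?_
  rw [mul_comm]
  exact mul_le_mul_of_nonneg_right h (norm_nonneg _)

theorem hasDerivAt_perimeter (c : Cylinder) {s : ℝ} (hs : s ∈ c.line) :
    HasDerivAt c.perimeter (c.perimeterDeriv s) s := by
  obtain ⟨C, -, hC⟩ := c.exists_dThetaS_bound
  have hc := c.continuous_dTheta
  have hd := c.continuous_dThetaS
  refine (intervalIntegral.hasDerivAt_integral_of_dominated_loc_of_deriv_le (μ := volume)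
    (a := 0) (b := 2 * Real.pi) (F := fun s θ => ‖c.dTheta (θ, s)‖)
    (F' := fun s θ => ⟪c.dTheta (θ, s), c.dThetaS (θ, s)⟫ / ‖c.dTheta (θ, s)‖)
    (bound := fun _ => C) (Ioo_mem_nhds hs.1 hs.2) ?_ ?_ ?_ ?_ ?_ ?_).2
  · exact Eventually.of_forall fun s => Continuous.aestronglyMeasurable (by fun_prop)
  · exact Continuous.intervalIntegrable (by fun_prop) _ _
  · apply AEMeasurable.aestronglyMeasurable
    apply Measurable.aemeasurable
    apply Measurable.div
    · exact Continuous.measurable (by fun_prop)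
    · exact Continuous.measurable (by fun_prop)
  · exact Eventually.of_forall fun θ _ x hx =>
      c.norm_integrand_le (hC θ x (Ioo_subset_Icc_self hx))
  · exact intervalIntegrable_const
  · exact Eventually.of_forall fun θ _ x hx => c.hasDerivAt_norm_dTheta (Ioo_subset_Icc_self hx) θ

theorem continuousOn_perimeterDeriv (c : Cylinder) : ContinuousOn c.perimeterDeriv c.line := by
  obtain ⟨C, -, hC⟩ := c.exists_dThetaS_bound
  have hc := c.continuous_dTheta
  have hd := c.continuous_dThetaS
  intro s hs
  refine intervalIntegral.continuousWithinAt_of_dominated_interval (bound := fun _ => C)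
    ?_ ?_ ?_ ?_
  · refine Eventually.of_forall fun s => ?_
    apply AEMeasurable.aestronglyMeasurable
    apply Measurable.aemeasurable
    apply Measurable.div
    · exact Continuous.measurable (by fun_prop)
    · exact Continuous.measurable (by fun_prop)
  · filter_upwards [self_mem_nhdsWithin] with x hx
    exact Eventually.of_forall fun θ _ => c.norm_integrand_le (hC θ x (Ioo_subset_Icc_self hx))
  · exact intervalIntegrable_const
  · refine Eventually.of_forall fun θ _ => ContinuousAt.continuousWithinAt ?_
    apply ContinuousAt.div
    · exact Continuous.continuousAt (by fun_prop)
    · exact Continuous.continuousAt (by fun_prop)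
    · exact norm_ne_zero_iff.2 (c.dTheta_ne_zero (Ioo_subset_Icc_self hs) θ)

theorem contDiffOn_perimeter (c : Cylinder) : ContDiffOn ℝ 1 c.perimeter c.line := by
  have h : ∀ s ∈ c.line, HasDerivAt c.perimeter (c.perimeterDeriv s) s :=
    fun s hs => c.hasDerivAt_perimeter hs
  rw [show (1 : WithTop ℕ∞) = 0 + 1 from rfl, contDiffOn_succ_iff_deriv_of_isOpen isOpen_Ioo]
  refine ⟨fun s hs => (h s hs).differentiableAt.differentiableWithinAt, by simp, ?_⟩
  rw [contDiffOn_zero]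
  exact c.continuousOn_perimeterDeriv.congr fun s hs => (h s hs).deriv

theorem memLp_perimeter (c : Cylinder) : MemLp c.perimeter ∞ (volume.restrict c.line) := by
  obtain ⟨C, hC⟩ := (isCompact_Icc (a := (0 : ℝ)) (b := c.S)).exists_bound_of_continuousOn
    c.continuous_perimeter.continuousOn
  refine memLp_top_of_bound c.continuous_perimeter.aestronglyMeasurable C ?_
  filter_upwards [ae_restrict_mem measurableSet_Ioo] with s hs
  exact hC s (Ioo_subset_Icc_self hs)

theorem memLp_perimeterDeriv (c : Cylinder) :
    MemLp c.perimeterDeriv ∞ (volume.restrict c.line) := by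
  obtain ⟨C, h0, hC⟩ := c.exists_dThetaS_bound
  refine memLp_top_of_bound
    (c.continuousOn_perimeterDeriv.aestronglyMeasurable measurableSet_Ioo)
    (C * |2 * Real.pi - 0|) ?_
  filter_upwards [ae_restrict_mem measurableSet_Ioo] with s hs
  exact intervalIntegral.norm_integral_le_of_norm_le_const fun θ _ =>
    c.norm_integrand_le (hC θ s (Ioo_subset_Icc_self hs))

theorem memLp_sectionArea (c : Cylinder) : MemLp c.sectionArea ∞ (volume.restrict c.line) := by
  obtain ⟨C, hC⟩ := (isCompact_Icc (a := (0 : ℝ)) (b := c.S)).exists_bound_of_continuousOn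
    c.continuous_sectionArea.continuousOn
  refine memLp_top_of_bound c.continuous_sectionArea.aestronglyMeasurable C ?_
  filter_upwards [ae_restrict_mem measurableSet_Ioo] with s hs
  exact hC s (Ioo_subset_Icc_self hs)

/-- The space `V̂ = H¹₀(Λ)`. -/
abbrev Vhat (c : Cylinder) : Submodule ℝ (SobolevPair c.line) := H10 c.line

/-- The function `v̂` underlying an element of `V̂`. -/
def val (c : Cylinder) : c.Vhat →L[ℝ] Lp ℝ 2 (volume.restrict c.line) :=
  (WithLp.fstL 2 ℝ _ _).comp c.Vhat.subtypeL

/-- The derivative `dv̂/ds` of an element of `V̂`. -/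
def der (c : Cylinder) : c.Vhat →L[ℝ] Lp ℝ 2 (volume.restrict c.line) :=
  (WithLp.sndL 2 ℝ _ _).comp c.Vhat.subtypeL

/-- `(v, v') ↦ (|Γ| v, |Γ| v' + |Γ|' v)`, on pairs of `L²` functions. -/
def perimeterMulPair (c : Cylinder) : SobolevPair c.line →L[ℝ] SobolevPair c.line :=
  (WithLp.prodContinuousLinearEquiv 2 ℝ _ _).symm.toContinuousLinearMap.comp
    (((scalarMul c.perimeter c.memLp_perimeter).comp (WithLp.fstL 2 ℝ _ _)).prod
      ((scalarMul c.perimeter c.memLp_perimeter).comp (WithLp.sndL 2 ℝ _ _) +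
        (scalarMul c.perimeterDeriv c.memLp_perimeterDeriv).comp (WithLp.fstL 2 ℝ _ _)))

theorem perimeterMulPair_test (c : Cylinder) {p : SobolevPair c.line} (hp : p ∈ testPairs c.line) :
    c.perimeterMulPair p ∈ testPairs c.line := by
  obtain ⟨φ, ⟨h1, h2, h3⟩, h4, h5⟩ := hp
  have hsub : tsupport (fun s => c.perimeter s * φ s) ⊆ tsupport φ :=
    tsupport_mul_subset_right (f := c.perimeter) (g := φ)
  refine ⟨fun s => c.perimeter s * φ s, ⟨?_, h2.mul_left, hsub.trans h3⟩, ?_, ?_⟩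
  · rw [contDiff_iff_contDiffAt]
    intro s
    by_cases hs : s ∈ tsupport φ
    · exact (c.contDiffOn_perimeter.contDiffAt (Ioo_mem_nhds (h3 hs).1 (h3 hs).2)).mul
        h1.contDiffAt
    · have : (fun s => c.perimeter s * φ s) =ᶠ[𝓝 s] fun _ => 0 :=
        notMem_tsupport_iff_eventuallyEq.1 fun h => hs (hsub h)
      exact contDiffAt_const.congr_of_eventuallyEq this
  · filter_upwards [h4, scalarMul_coe c.perimeter c.memLp_perimeter p.fst] with s a b
    exact b.trans (by rw [a])
  · have hadd := Lp.coeFn_add (scalarMul c.perimeter c.memLp_perimeter p.snd)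
      (scalarMul c.perimeterDeriv c.memLp_perimeterDeriv p.fst)
    filter_upwards [h4, h5, scalarMul_coe c.perimeter c.memLp_perimeter p.snd,
      scalarMul_coe c.perimeterDeriv c.memLp_perimeterDeriv p.fst, hadd,
      ae_restrict_mem measurableSet_Ioo] with s a b d e f hs
    refine f.trans ?_
    have hprod : deriv (fun s => c.perimeter s * φ s) s =
        c.perimeterDeriv s * φ s + c.perimeter s * deriv φ s :=
      ((c.hasDerivAt_perimeter hs).mul (h1.differentiable one_ne_zero s).hasDerivAt).deriv
    rw [Pi.add_apply, d, e, a, b, gradient_eq_deriv', gradient_eq_deriv', hprod]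
    ring

theorem perimeterMulPair_mem (c : Cylinder) (p : SobolevPair c.line) (hp : p ∈ c.Vhat) :
    c.perimeterMulPair p ∈ c.Vhat :=
  map_mem_closure c.perimeterMulPair.continuous hp fun _ h => c.perimeterMulPair_test h

/-- Multiplication `v̂ ↦ |Γ| v̂` on `V̂`. -/
def perimeterMul (c : Cylinder) : c.Vhat →L[ℝ] c.Vhat :=
  (c.perimeterMulPair.comp c.Vhat.subtypeL).codRestrict c.Vhat fun v =>
    c.perimeterMulPair_mem v v.2

theorem perimeterMul_val (c : Cylinder) (v : c.Vhat) :
    c.val (c.perimeterMul v) =ᵐ[volume.restrict c.line] fun s => c.perimeter s * c.val v s :=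
  scalarMul_coe c.perimeter c.memLp_perimeter (c.val v)

end Cylinder

/-! ### The extension operator into `H^{1/2}(Γ)` -/

theorem rpow_neg_anti {a b : ℝ≥0∞} (h : a ≤ b) {r : ℝ} (hr : 0 ≤ r) : b ^ (-r) ≤ a ^ (-r) := by
  rw [ENNReal.rpow_neg, ENNReal.rpow_neg]
  exact ENNReal.inv_le_inv.2 (ENNReal.rpow_le_rpow h hr)

theorem lintegral_singular_lt_top (a : ℝ) {r : ℝ} (hr : r < 1) :
    ∫⁻ y in Ioo (-a) a, ‖y‖ₑ ^ (-r) < ∞ := by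
  have h : IntegrableOn (fun y : ℝ => ‖y‖ ^ (-r)) (Metric.ball 0 a) := by
    apply integrableOn_ball_of_norm_le_rpow (C := 1) (α := r) (by simp)
    · simpa using hr
    · exact Eventually.of_forall fun y => by simp [abs_of_nonneg, Real.rpow_nonneg]
    · exact (Measurable.aestronglyMeasurable (by fun_prop))
  have h2 := h.2
  rw [Real.ball_eq_Ioo, zero_sub, zero_add] at h2
  refine lt_of_le_of_lt (lintegral_mono_ae ?_) h2
  have h0 : ∀ᵐ y : ℝ ∂(volume.restrict (Ioo (-a) a)), y ≠ 0 := by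
    apply ae_restrict_of_ae
    simp [ae_iff]
  filter_upwards [h0] with y hy
  have e : ‖y‖ₑ = ENNReal.ofReal ‖y‖ := (ofReal_norm y).symm
  rw [e, ENNReal.ofReal_rpow_of_pos (norm_pos_iff.2 hy), ← ofReal_norm]
  exact ENNReal.ofReal_le_ofReal (le_abs_self _)

theorem lintegral_singular_shift (b c : ℝ) {r : ℝ} (hr : r < 1) :
    ∫⁻ y in Ioo (-b) b, ‖y - c‖ₑ ^ (-r) < ∞ := by
  have h := lintegral_singular_lt_top (b + |c|) hr
  have e : ∀ y : ℝ, (Ioo (-b) b).indicator (fun y => ‖y - c‖ₑ ^ (-r)) y ≤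
      (fun y => (Ioo (-(b + |c|)) (b + |c|)).indicator (fun y => ‖y‖ₑ ^ (-r)) y) (y - c) := by
    intro y
    by_cases hy : y ∈ Ioo (-b) b
    · have : y - c ∈ Ioo (-(b + |c|)) (b + |c|) := by
        have := neg_abs_le c
        have := le_abs_self c
        constructor <;> linarith [hy.1, hy.2]
      rw [indicator_of_mem hy]
      simp only [indicator_of_mem this, le_refl]
    · rw [indicator_of_notMem hy]
      exact zero_le
  rw [← lintegral_indicator measurableSet_Ioo] at h ⊢
  refine (lintegral_mono e).trans_lt ?_
  rwa [lintegral_sub_right_eq_self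
    (fun y => (Ioo (-(b + |c|)) (b + |c|)).indicator (fun y => ‖y‖ₑ ^ (-r)) y) c]

/-- The singular kernel in the angular variable is integrable. -/
theorem lintegral_sin_lt_top :
    ∫⁻ y in Ioo (-(2 * Real.pi)) (2 * Real.pi), ‖Real.sin (y / 2)‖ₑ ^ (-(1 / 2) : ℝ) < ∞ := by
  have hpi := Real.pi_pos
  have key : ∀ y : ℝ, |y| ≤ Real.pi → ‖Real.sin (y / 2)‖ₑ ^ (-(1 / 2) : ℝ) ≤
      ENNReal.ofReal (1 / Real.pi) ^ (-(1 / 2) : ℝ) * ‖y‖ₑ ^ (-(1 / 2) : ℝ) := by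
    intro y hy
    have h1 : |y / 2| ≤ Real.pi / 2 := by
      rw [abs_div, abs_two]
      linarith
    have h2 := Real.mul_abs_le_abs_sin h1
    have h3 : ENNReal.ofReal (1 / Real.pi) * ‖y‖ₑ ≤ ‖Real.sin (y / 2)‖ₑ := by
      rw [← ofReal_norm, ← ofReal_norm, ← ENNReal.ofReal_mul (by positivity)]
      apply ENNReal.ofReal_le_ofReal
      rw [Real.norm_eq_abs, Real.norm_eq_abs]
      refine le_trans (le_of_eq ?_) h2
      rw [abs_div, abs_two]
      field_simp
    refine (rpow_neg_anti h3 (by norm_num)).trans (le_of_eq ?_)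
    rw [ENNReal.mul_rpow_of_ne_top ENNReal.ofReal_ne_top enorm_ne_top]
  have hC : ENNReal.ofReal (1 / Real.pi) ^ (-(1 / 2) : ℝ) ≠ ∞ :=
    ENNReal.rpow_ne_top_of_ne_zero (by simpa using hpi) ENNReal.ofReal_ne_top
  have le1 : ∀ y ∈ Ioo (-(2 * Real.pi)) (2 * Real.pi),
      ‖Real.sin (y / 2)‖ₑ ^ (-(1 / 2) : ℝ) ≤ ENNReal.ofReal (1 / Real.pi) ^ (-(1 / 2) : ℝ) *
        (‖y - 0‖ₑ ^ (-(1 / 2) : ℝ) + (‖y - 2 * Real.pi‖ₑ ^ (-(1 / 2) : ℝ) +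
          ‖y - -(2 * Real.pi)‖ₑ ^ (-(1 / 2) : ℝ))) := by
    intro y hy
    rw [mul_add, mul_add]
    rcases le_total |y| Real.pi with h | h
    · refine (key y h).trans ?_
      rw [sub_zero]
      exact le_self_add
    · rcases le_total 0 y with h0 | h0
      · rw [abs_of_nonneg h0] at h
        have h5 : |y - 2 * Real.pi| ≤ Real.pi := by
          rw [abs_le]
          constructor <;> linarith [hy.2]
        have := key _ h5
        rw [show (y - 2 * Real.pi) / 2 = y / 2 - Real.pi by ring, Real.sin_sub_pi, enorm_neg] at this
        exact this.trans (le_self_add.trans le_add_self)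
      · rw [abs_of_nonpos h0] at h
        have h5 : |y - -(2 * Real.pi)| ≤ Real.pi := by
          rw [abs_le]
          constructor <;> linarith [hy.1]
        have := key _ h5
        rw [show (y - -(2 * Real.pi)) / 2 = y / 2 + Real.pi by ring, Real.sin_add_pi,
          enorm_neg] at this
        exact this.trans (le_add_self.trans le_add_self)
  have hm : ∀ c : ℝ, Measurable fun y : ℝ => ‖y - c‖ₑ ^ (-(1 / 2) : ℝ) := fun c => by fun_prop
  refine (setLIntegral_mono' measurableSet_Ioo le1).trans_lt ?_
  rw [lintegral_const_mul' _ _ hC, lintegral_add_left (hm 0),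
    lintegral_add_left (hm _)]
  exact ENNReal.mul_lt_top hC.lt_top (ENNReal.add_lt_top.2
    ⟨lintegral_singular_shift _ _ (by norm_num), ENNReal.add_lt_top.2
      ⟨lintegral_singular_shift _ _ (by norm_num),
        lintegral_singular_shift _ _ (by norm_num)⟩⟩)

/-- Cauchy–Schwarz for the increment of a `C¹` function. -/
theorem enorm_sub_sq_le {φ : ℝ → ℝ} (hφ : ContDiff ℝ 1 φ) (s t : ℝ) :
    ‖φ s - φ t‖ₑ ^ (2 : ℝ) ≤ ‖s - t‖ₑ * ∫⁻ x in Set.uIoc t s, ‖deriv φ x‖ₑ ^ (2 : ℝ) := by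
  have hd : Continuous (deriv φ) := hφ.continuous_deriv le_rfl
  have h1 : ∫ x in t..s, deriv φ x = φ s - φ t :=
    intervalIntegral.integral_deriv_eq_sub (fun x _ => hφ.differentiable one_ne_zero x)
      (hd.intervalIntegrable _ _)
  have h2 : ‖φ s - φ t‖ₑ ≤ ∫⁻ x in Set.uIoc t s, ‖deriv φ x‖ₑ := by
    rw [← h1, ← ofReal_norm, intervalIntegral.norm_intervalIntegral_eq,
      ofReal_norm]
    exact enorm_integral_le_lintegral_enorm _
  have hm : Measurable fun x => ‖deriv φ x‖ₑ := hd.measurable.enorm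
  have h3 := ENNReal.lintegral_mul_le_Lp_mul_Lq (volume.restrict (Set.uIoc t s))
    Real.HolderConjugate.two_two hm.aemeasurable (g := fun _ => 1) aemeasurable_const
  simp only [Pi.mul_apply, mul_one, ENNReal.one_rpow, lintegral_const,
    Measure.restrict_apply_univ, one_mul, Real.volume_uIoc] at h3
  have h4 := ENNReal.rpow_le_rpow (h2.trans h3) (zero_le_two (α := ℝ))
  refine h4.trans (le_of_eq ?_)
  rw [ENNReal.mul_rpow_of_nonneg _ _ zero_le_two, ← ENNReal.rpow_mul, ← ENNReal.rpow_mul]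
  norm_num
  rw [mul_comm, ← ofReal_norm, Real.norm_eq_abs]

namespace Cylinder

theorem lateral_sub (c : Cylinder) (z w : ℝ × ℝ) : c.lateral z - c.lateral w =
    (z.2 - w.2) • c.dir + ((Real.cos z.1 • c.semi₁ z.2 + Real.sin z.1 • c.semi₂ z.2) -
      (Real.cos w.1 • c.semi₁ w.2 + Real.sin w.1 • c.semi₂ w.2)) := by
  simp only [lateral, point, one_smul, sub_smul]
  abel

theorem abs_sub_le_dist (c : Cylinder) {z w : ℝ × ℝ} (hz : z.2 ∈ Icc 0 c.S)
    (hw : w.2 ∈ Icc 0 c.S) : |z.2 - w.2| ≤ ‖c.lateral z - c.lateral w‖ := by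
  have h1 := c.axial_lateral hz
  have h2 := c.axial_lateral hw
  have h3 : z.2 - w.2 = ⟪c.lateral z - c.lateral w, c.dir⟫ := by
    rw [← h1, ← h2, axial, axial, ← inner_sub_left]
    congr 1
    simp
  rw [h3]
  refine (abs_real_inner_le_norm _ _).trans ?_
  rw [c.dir_norm, mul_one]

/-- Lower bound for the distance of two points of the lateral surface. -/
theorem exists_sin_le_dist (c : Cylinder) : ∃ K : ℝ, 0 < K ∧ ∀ z w : ℝ × ℝ,
    z.2 ∈ Icc 0 c.S → w.2 ∈ Icc 0 c.S →
      |Real.sin ((z.1 - w.1) / 2)| ≤ K * ‖c.lateral z - c.lateral w‖ := by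
  have hne : (Icc 0 c.S).Nonempty := ⟨0, le_rfl, c.S_pos.le⟩
  obtain ⟨s1, hs1, hm1⟩ := isCompact_Icc.exists_isMinOn hne
    (c.smooth₁.continuous.norm).continuousOn
  obtain ⟨s2, hs2, hm2⟩ := isCompact_Icc.exists_isMinOn hne
    (c.smooth₂.continuous.norm).continuousOn
  obtain ⟨C1, h1⟩ := (isCompact_Icc (a := (0 : ℝ)) (b := c.S)).exists_bound_of_continuousOn
    (c.smooth₁.continuous_deriv le_rfl).continuousOn
  obtain ⟨C2, h2⟩ := (isCompact_Icc (a := (0 : ℝ)) (b := c.S)).exists_bound_of_continuousOn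
    (c.smooth₂.continuous_deriv le_rfl).continuousOn
  have h0 : (0 : ℝ) ∈ Icc 0 c.S := ⟨le_rfl, c.S_pos.le⟩
  have p1 := (norm_nonneg _).trans (h1 0 h0)
  have p2 := (norm_nonneg _).trans (h2 0 h0)
  have lip1 : ∀ s ∈ Icc 0 c.S, ∀ t ∈ Icc 0 c.S, ‖c.semi₁ s - c.semi₁ t‖ ≤ C1 * |s - t| := by
    intro s hs t ht
    exact (convex_Icc 0 c.S).norm_image_sub_le_of_norm_deriv_le
      (fun x _ => c.smooth₁.differentiable one_ne_zero x) h1 ht hs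
  have lip2 : ∀ s ∈ Icc 0 c.S, ∀ t ∈ Icc 0 c.S, ‖c.semi₂ s - c.semi₂ t‖ ≤ C2 * |s - t| := by
    intro s hs t ht
    exact (convex_Icc 0 c.S).norm_image_sub_le_of_norm_deriv_le
      (fun x _ => c.smooth₂.differentiable one_ne_zero x) h2 ht hs
  set m := min ‖c.semi₁ s1‖ ‖c.semi₂ s2‖ with hm
  have mpos : 0 < m := lt_min (norm_pos_iff.2 (c.semi₁_ne s1 hs1)) (norm_pos_iff.2 (c.semi₂_ne s2 hs2))
  refine ⟨(2 + C1 + C2) / (2 * m), by positivity, fun z w hz hw => ?_⟩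
  set d := ‖c.lateral z - c.lateral w‖ with hd
  have hst : |z.2 - w.2| ≤ d := c.abs_sub_le_dist hz hw
  set A : E3 := (Real.cos z.1 - Real.cos w.1) • c.semi₁ z.2 +
    (Real.sin z.1 - Real.sin w.1) • c.semi₂ z.2 with hA
  set B : E3 := Real.cos w.1 • (c.semi₁ z.2 - c.semi₁ w.2) +
    Real.sin w.1 • (c.semi₂ z.2 - c.semi₂ w.2) with hB
  have hsum : c.lateral z - c.lateral w = (z.2 - w.2) • c.dir + (A + B) := by
    rw [c.lateral_sub, hA, hB]
    congr 1
    simp only [sub_smul, smul_sub]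
    abel
  have hBn : ‖B‖ ≤ (C1 + C2) * d := by
    refine (norm_add_le _ _).trans ?_
    rw [norm_smul, norm_smul]
    have a1 : ‖Real.cos w.1‖ ≤ 1 := Real.abs_cos_le_one _
    have a2 : ‖Real.sin w.1‖ ≤ 1 := Real.abs_sin_le_one _
    have b1 := mul_le_mul a1 (lip1 _ hz _ hw) (norm_nonneg _) zero_le_one
    have b2 := mul_le_mul a2 (lip2 _ hz _ hw) (norm_nonneg _) zero_le_one
    have b3 := mul_le_mul_of_nonneg_left hst p1
    have b4 := mul_le_mul_of_nonneg_left hst p2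
    linarith
  have hAn : ‖A‖ ≤ (2 + C1 + C2) * d := by
    have e : A = (c.lateral z - c.lateral w) - (z.2 - w.2) • c.dir - B := by
      rw [hsum]
      abel
    rw [e]
    refine (norm_sub_le _ _).trans ((add_le_add (norm_sub_le _ _) hBn).trans ?_)
    rw [norm_smul, c.dir_norm, mul_one, Real.norm_eq_abs, ← hd]
    linarith
  have hAsq : ‖A‖ ^ 2 = (Real.cos z.1 - Real.cos w.1) ^ 2 * ‖c.semi₁ z.2‖ ^ 2 +
      (Real.sin z.1 - Real.sin w.1) ^ 2 * ‖c.semi₂ z.2‖ ^ 2 := by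
    rw [hA, norm_add_sq_real, inner_smul_left, inner_smul_right, c.orth₁₂ _ hz, norm_smul,
      norm_smul, mul_pow, mul_pow, Real.norm_eq_abs, Real.norm_eq_abs, sq_abs, sq_abs]
    simp
  have hm1' : m ≤ ‖c.semi₁ z.2‖ := (min_le_left _ _).trans (hm1 hz)
  have hm2' : m ≤ ‖c.semi₂ z.2‖ := (min_le_right _ _).trans (hm2 hz)
  have hsin : (2 * Real.sin ((z.1 - w.1) / 2)) ^ 2 =
      (Real.cos z.1 - Real.cos w.1) ^ 2 + (Real.sin z.1 - Real.sin w.1) ^ 2 := by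
    have e1 := Real.sin_sq_add_cos_sq z.1
    have e2 := Real.sin_sq_add_cos_sq w.1
    have e3 := Real.cos_sub z.1 w.1
    have e4 : Real.cos (z.1 - w.1) = 1 - 2 * Real.sin ((z.1 - w.1) / 2) ^ 2 := by
      have := Real.cos_two_mul' ((z.1 - w.1) / 2)
      have e5 := Real.sin_sq_add_cos_sq ((z.1 - w.1) / 2)
      rw [mul_div_cancel₀ _ two_ne_zero] at this
      linarith
    nlinarith
  have hfin : (2 * m * |Real.sin ((z.1 - w.1) / 2)|) ^ 2 ≤ ‖A‖ ^ 2 := by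
    have e : (2 * m * |Real.sin ((z.1 - w.1) / 2)|) ^ 2 =
        m ^ 2 * (2 * Real.sin ((z.1 - w.1) / 2)) ^ 2 := by
      rw [mul_pow, mul_pow, sq_abs]
      ring
    rw [e, hsin, hAsq]
    have q1 : m ^ 2 ≤ ‖c.semi₁ z.2‖ ^ 2 := pow_le_pow_left₀ mpos.le hm1' 2
    have q2 : m ^ 2 ≤ ‖c.semi₂ z.2‖ ^ 2 := pow_le_pow_left₀ mpos.le hm2' 2
    nlinarith [mul_le_mul_of_nonneg_left q1 (sq_nonneg (Real.cos z.1 - Real.cos w.1)),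
      mul_le_mul_of_nonneg_left q2 (sq_nonneg (Real.sin z.1 - Real.sin w.1))]
  have hlast := (le_abs_self _).trans (abs_le_of_sq_le_sq hfin (norm_nonneg _))
  rw [div_mul_eq_mul_div, le_div_iff₀ (by positivity)]
  linarith

/-- The difference quotient `(v(x) - v(y)) / |x - y|^{3/2}` of the extension of `v` to `Γ`. -/
def extQuot (c : Cylinder) (v : ℝ → ℝ) (p : E3 × E3) : ℝ :=
  (v (c.axial p.1) - v (c.axial p.2)) / ‖p.1 - p.2‖ ^ (3 / 2 : ℝ)

theorem exists_quot_le (c : Cylinder) : ∃ K : ℝ≥0∞, K ≠ ∞ ∧ ∀ φ : ℝ → ℝ, ContDiff ℝ 1 φ →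
    ∀ z ∈ c.params, ∀ w ∈ c.params,
      ‖c.extQuot φ (c.lateral z, c.lateral w)‖ₑ ^ (2 : ℝ) ≤
        K * (‖Real.sin ((z.1 - w.1) / 2)‖ₑ ^ (-(1 / 2) : ℝ) *
          ∫⁻ x in c.line, ‖deriv φ x‖ₑ ^ (2 : ℝ) *
            (‖z.2 - x‖ₑ ^ (-(3 / 4) : ℝ) * ‖x - w.2‖ₑ ^ (-(3 / 4) : ℝ))) := by
  obtain ⟨K, hK, hdist⟩ := c.exists_sin_le_dist
  have hK0 : ENNReal.ofReal K ≠ 0 := by simpa using hK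
  refine ⟨(ENNReal.ofReal K) ^ (1 / 2 : ℝ), ENNReal.rpow_ne_top_of_nonneg (by norm_num)
    ENNReal.ofReal_ne_top, fun φ hφ z hz w hw => ?_⟩
  have hz2 := Ioo_subset_Icc_self hz.2
  have hw2 := Ioo_subset_Icc_self hw.2
  simp only [extQuot]
  rw [c.axial_lateral hz2, c.axial_lateral hw2]
  rcases eq_or_ne z.2 w.2 with heq | hne
  · rw [heq, sub_self, zero_div, enorm_zero, ENNReal.zero_rpow_of_pos two_pos]
    exact zero_le
  set s := z.2
  set t := w.2
  set d := ‖c.lateral z - c.lateral w‖ with hd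
  have hst : |s - t| ≤ d := c.abs_sub_le_dist hz2 hw2
  have hstpos : 0 < |s - t| := abs_pos.2 (sub_ne_zero.2 hne)
  have hdpos : 0 < d := hstpos.trans_le hst
  have e0 : ‖s - t‖ₑ ≠ 0 := by simpa [sub_eq_zero] using hne
  have e1 : ‖s - t‖ₑ ≠ ∞ := enorm_ne_top
  have hd_e : ‖s - t‖ₑ ≤ ENNReal.ofReal d := by
    rw [← ofReal_norm, Real.norm_eq_abs]
    exact ENNReal.ofReal_le_ofReal hst
  have hsin_e : ‖Real.sin ((z.1 - w.1) / 2)‖ₑ ≤ ENNReal.ofReal K * ENNReal.ofReal d := by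
    rw [← ofReal_norm, Real.norm_eq_abs, ← ENNReal.ofReal_mul hK.le]
    exact ENNReal.ofReal_le_ofReal (hdist z w hz2 hw2)
  have step1 : ‖(φ s - φ t) / d ^ (3 / 2 : ℝ)‖ₑ ^ (2 : ℝ) =
      ‖φ s - φ t‖ₑ ^ (2 : ℝ) * ENNReal.ofReal d ^ (-3 : ℝ) := by
    rw [div_eq_mul_inv, enorm_mul, ENNReal.mul_rpow_of_nonneg _ _ zero_le_two]
    congr 1
    rw [← Real.rpow_neg hdpos.le, Real.enorm_eq_ofReal (by positivity),
      ← ENNReal.ofReal_rpow_of_pos hdpos, ← ENNReal.rpow_mul]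
    norm_num
  have hd0 : ENNReal.ofReal d ≠ 0 := by simpa using hdpos
  have step2 : ENNReal.ofReal d ^ (-3 : ℝ) ≤ ‖s - t‖ₑ ^ (-(5 / 2) : ℝ) *
      (ENNReal.ofReal K ^ (1 / 2 : ℝ) * ‖Real.sin ((z.1 - w.1) / 2)‖ₑ ^ (-(1 / 2) : ℝ)) := by
    have a : ENNReal.ofReal d ^ (-3 : ℝ) =
        ENNReal.ofReal d ^ (-(5 / 2) : ℝ) * ENNReal.ofReal d ^ (-(1 / 2) : ℝ) := by
      rw [← ENNReal.rpow_add _ _ hd0 ENNReal.ofReal_ne_top]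
      norm_num
    rw [a]
    refine mul_le_mul' (rpow_neg_anti hd_e (by norm_num)) ?_
    have b := rpow_neg_anti hsin_e (r := 1 / 2) (by norm_num)
    rw [ENNReal.mul_rpow_of_ne_top ENNReal.ofReal_ne_top ENNReal.ofReal_ne_top] at b
    have b2 := mul_le_mul_right b (ENNReal.ofReal K ^ (1 / 2 : ℝ))
    refine le_trans (le_of_eq ?_) b2
    rw [← mul_assoc, ← ENNReal.rpow_add _ _ hK0 ENNReal.ofReal_ne_top]
    norm_num
  have step3 : ‖s - t‖ₑ * ‖s - t‖ₑ ^ (-(5 / 2) : ℝ) =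
      ‖s - t‖ₑ ^ (-(3 / 4) : ℝ) * ‖s - t‖ₑ ^ (-(3 / 4) : ℝ) := by
    nth_rewrite 1 [← ENNReal.rpow_one ‖s - t‖ₑ]
    rw [← ENNReal.rpow_add _ _ e0 e1, ← ENNReal.rpow_add _ _ e0 e1]
    norm_num
  have step4 : (∫⁻ x in Set.uIoc t s, ‖deriv φ x‖ₑ ^ (2 : ℝ)) *
      (‖s - t‖ₑ ^ (-(3 / 4) : ℝ) * ‖s - t‖ₑ ^ (-(3 / 4) : ℝ)) ≤
      ∫⁻ x in c.line, ‖deriv φ x‖ₑ ^ (2 : ℝ) *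
            (‖s - x‖ₑ ^ (-(3 / 4) : ℝ) * ‖x - t‖ₑ ^ (-(3 / 4) : ℝ)) := by
    rw [← lintegral_mul_const' _ _ (ENNReal.mul_ne_top
      (ENNReal.rpow_ne_top_of_ne_zero e0 e1) (ENNReal.rpow_ne_top_of_ne_zero e0 e1))]
    have hsub : Set.uIoc t s ⊆ c.line := by
      intro x hx
      rw [Set.mem_uIoc] at hx
      have := hz.2
      have := hw.2
      rcases hx with hx | hx
      · exact ⟨hw.2.1.trans hx.1, hx.2.trans_lt hz.2.2⟩
      · exact ⟨hz.2.1.trans hx.1, hx.2.trans_lt hw.2.2⟩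
    refine (setLIntegral_mono' measurableSet_uIoc fun x hx => ?_).trans
      (lintegral_mono_set hsub)
    have hx' : |s - x| ≤ |s - t| ∧ |x - t| ≤ |s - t| := by
      rw [Set.mem_uIoc] at hx
      rcases hx with hx | hx
      · rw [abs_of_nonneg (by linarith), abs_of_nonneg (by linarith),
          abs_of_nonneg (by linarith)]
        constructor <;> linarith
      · rw [abs_of_nonpos (by linarith), abs_of_nonpos (by linarith),
          abs_of_nonpos (by linarith)]
        constructor <;> linarith
    refine mul_le_mul' le_rfl (mul_le_mul' ?_ ?_)
    · apply rpow_neg_anti _ (by norm_num)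
      rw [← ofReal_norm, ← ofReal_norm]
      exact ENNReal.ofReal_le_ofReal hx'.1
    · apply rpow_neg_anti _ (by norm_num)
      rw [← ofReal_norm, ← ofReal_norm]
      exact ENNReal.ofReal_le_ofReal hx'.2
  rw [step1]
  refine (mul_le_mul' (enorm_sub_sq_le hφ s t) step2).trans ?_
  calc ‖s - t‖ₑ * (∫⁻ x in Set.uIoc t s, ‖deriv φ x‖ₑ ^ (2 : ℝ)) * (‖s - t‖ₑ ^ (-(5 / 2) : ℝ) *
        (ENNReal.ofReal K ^ (1 / 2 : ℝ) * ‖Real.sin ((z.1 - w.1) / 2)‖ₑ ^ (-(1 / 2) : ℝ)))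
      = (ENNReal.ofReal K ^ (1 / 2 : ℝ) * ‖Real.sin ((z.1 - w.1) / 2)‖ₑ ^ (-(1 / 2) : ℝ)) *
        ((∫⁻ x in Set.uIoc t s, ‖deriv φ x‖ₑ ^ (2 : ℝ)) *
          (‖s - t‖ₑ * ‖s - t‖ₑ ^ (-(5 / 2) : ℝ))) := by ring
    _ ≤ _ := by
      rw [step3]
      exact (mul_le_mul' le_rfl step4).trans (le_of_eq (mul_assoc _ _ _))

end Cylinder

namespace Cylinder

theorem exists_lintegral_surface_le (c : Cylinder) : ∃ C : ℝ≥0∞, C ≠ ∞ ∧ ∀ f : E3 → ℝ≥0∞,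
    Measurable f → ∫⁻ x, f x ∂c.surface ≤ C * ∫⁻ z in c.params, f (c.lateral z) := by
  obtain ⟨C, hC, hle⟩ := c.exists_density_le
  refine ⟨C, hC, fun f hf => ?_⟩
  rw [surface, lintegral_map hf c.continuous_lateral.measurable]
  refine (lintegral_mono' hle le_rfl).trans (le_of_eq ?_)
  rw [lintegral_smul_measure, smul_eq_mul]

theorem measurable_extQuot (c : Cylinder) {v : ℝ → ℝ} (hv : Measurable v) :
    Measurable (c.extQuot v) := by
  have h := c.continuous_axial.measurable
  unfold extQuot
  fun_prop

theorem lintegral_kernel_le (c : Cylinder) {D : ℝ → ℝ≥0∞} (hD : Measurable D) :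
    ∫⁻ s in c.line, ∫⁻ t in c.line, ∫⁻ x in c.line,
        D x * (‖s - x‖ₑ ^ (-(3 / 4) : ℝ) * ‖x - t‖ₑ ^ (-(3 / 4) : ℝ)) ≤
      (∫⁻ y in Ioo (-c.S) c.S, ‖y‖ₑ ^ (-(3 / 4) : ℝ)) ^ 2 * ∫⁻ x in c.line, D x := by
  set P : ℝ≥0∞ := ∫⁻ y in Ioo (-c.S) c.S, ‖y‖ₑ ^ (-(3 / 4) : ℝ) with hP
  have shift : ∀ x ∈ c.line, ∫⁻ t in c.line, ‖x - t‖ₑ ^ (-(3 / 4) : ℝ) ≤ P := by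
    intro x hx
    rw [hP, ← lintegral_indicator measurableSet_Ioo, ← lintegral_indicator measurableSet_Ioo]
    rw [← lintegral_sub_left_eq_self
      ((Ioo (-c.S) c.S).indicator fun y : ℝ => ‖y‖ₑ ^ (-(3 / 4) : ℝ)) x]
    refine lintegral_mono fun t => ?_
    by_cases ht : t ∈ c.line
    · have : x - t ∈ Ioo (-c.S) c.S := by
        constructor <;> linarith [hx.1, hx.2, ht.1, ht.2]
      rw [indicator_of_mem ht]
      simp only [indicator_of_mem this, le_refl]
    · rw [indicator_of_notMem ht]
      exact zero_le
  have shift' : ∀ x ∈ c.line, ∫⁻ s in c.line, ‖s - x‖ₑ ^ (-(3 / 4) : ℝ) ≤ P := by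
    intro x hx
    refine le_trans (le_of_eq ?_) (shift x hx)
    refine lintegral_congr fun s => ?_
    rw [enorm_sub_rev]
  have inner : ∀ s : ℝ, ∫⁻ t in c.line, ∫⁻ x in c.line,
      D x * (‖s - x‖ₑ ^ (-(3 / 4) : ℝ) * ‖x - t‖ₑ ^ (-(3 / 4) : ℝ)) ≤
      P * ∫⁻ x in c.line, D x * ‖s - x‖ₑ ^ (-(3 / 4) : ℝ) := by
    intro s
    rw [lintegral_lintegral_swap (Measurable.aemeasurable (by
      simp only [Function.uncurry_def]
      fun_prop)), ← lintegral_const_mul _ (by fun_prop)]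
    refine setLIntegral_mono' measurableSet_Ioo fun x hx => ?_
    have e : ∀ t : ℝ, D x * (‖s - x‖ₑ ^ (-(3 / 4) : ℝ) * ‖x - t‖ₑ ^ (-(3 / 4) : ℝ)) =
        (D x * ‖s - x‖ₑ ^ (-(3 / 4) : ℝ)) * ‖x - t‖ₑ ^ (-(3 / 4) : ℝ) := fun t => by ring
    simp only [e]
    rw [lintegral_const_mul _ (by fun_prop), mul_comm P]
    exact mul_le_mul' le_rfl (shift x hx)
  refine (lintegral_mono inner).trans ?_
  rw [lintegral_const_mul _ (by fun_prop), lintegral_lintegral_swap (Measurable.aemeasurable (by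
      simp only [Function.uncurry_def]
      fun_prop)), pow_two, mul_assoc]
  refine mul_le_mul' le_rfl ?_
  rw [← lintegral_const_mul _ hD]
  refine setLIntegral_mono' measurableSet_Ioo fun x hx => ?_
  rw [lintegral_const_mul _ (by fun_prop), mul_comm P]
  exact mul_le_mul' le_rfl (shift' x hx)

theorem exists_lintegral_extQuot_le (c : Cylinder) : ∃ C : ℝ≥0∞, C ≠ ∞ ∧ ∀ φ : ℝ → ℝ,
    ContDiff ℝ 1 φ → ∫⁻ p, ‖c.extQuot φ p‖ₑ ^ (2 : ℝ) ∂(c.surface.prod c.surface) ≤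
      C * ∫⁻ x in c.line, ‖deriv φ x‖ₑ ^ (2 : ℝ) := by
  obtain ⟨C, hC, hsurf⟩ := c.exists_lintegral_surface_le
  obtain ⟨K, hK, hquot⟩ := c.exists_quot_le
  set N : ℝ≥0∞ := ∫⁻ y in Ioo (-(2 * Real.pi)) (2 * Real.pi),
    ‖Real.sin (y / 2)‖ₑ ^ (-(1 / 2) : ℝ) with hN
  set P : ℝ≥0∞ := ∫⁻ y in Ioo (-c.S) c.S, ‖y‖ₑ ^ (-(3 / 4) : ℝ) with hP
  have hNtop : N ≠ ∞ := lintegral_sin_lt_top.ne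
  have hPtop : P ≠ ∞ := (lintegral_singular_lt_top c.S (by norm_num)).ne
  refine ⟨C * C * K * N * ENNReal.ofReal (2 * Real.pi) * P ^ 2, by finiteness, fun φ hφ => ?_⟩
  have hm : Measurable fun p => ‖c.extQuot φ p‖ₑ ^ (2 : ℝ) :=
    (c.measurable_extQuot hφ.continuous.measurable).enorm.pow_const _
  set D : ℝ → ℝ≥0∞ := fun x => ‖deriv φ x‖ₑ ^ (2 : ℝ) with hD
  have hDm : Measurable D := (hφ.continuous_deriv le_rfl).measurable.enorm.pow_const _
  set G : ℝ → ℝ → ℝ≥0∞ := fun s t => ∫⁻ x in c.line,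
    D x * (‖s - x‖ₑ ^ (-(3 / 4) : ℝ) * ‖x - t‖ₑ ^ (-(3 / 4) : ℝ)) with hG
  have hGm : Measurable (Function.uncurry G) := by
    simp only [hG, Function.uncurry_def]
    apply Measurable.lintegral_prod_right' (f := fun q : (ℝ × ℝ) × ℝ =>
      D q.2 * (‖q.1.1 - q.2‖ₑ ^ (-(3 / 4) : ℝ) * ‖q.2 - q.1.2‖ₑ ^ (-(3 / 4) : ℝ)))
    fun_prop
  have hGs : ∀ s, Measurable (G s) := fun s => hGm.of_uncurry_left
  have hpm : MeasurableSet c.params := measurableSet_Ioo.prod measurableSet_Ioo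
  have ang : ∀ θ ∈ Ioo 0 (2 * Real.pi), ∫⁻ θ' in Ioo 0 (2 * Real.pi),
      ‖Real.sin ((θ - θ') / 2)‖ₑ ^ (-(1 / 2) : ℝ) ≤ N := by
    intro θ hθ
    rw [hN, ← lintegral_indicator measurableSet_Ioo, ← lintegral_indicator measurableSet_Ioo,
      ← lintegral_sub_left_eq_self ((Ioo (-(2 * Real.pi)) (2 * Real.pi)).indicator
        fun y : ℝ => ‖Real.sin (y / 2)‖ₑ ^ (-(1 / 2) : ℝ)) θ]
    refine lintegral_mono fun t => ?_
    by_cases ht : t ∈ Ioo 0 (2 * Real.pi)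
    · have : θ - t ∈ Ioo (-(2 * Real.pi)) (2 * Real.pi) := by
        constructor <;> linarith [hθ.1, hθ.2, ht.1, ht.2]
      rw [indicator_of_mem ht]
      simp only [indicator_of_mem this, le_refl]
    · rw [indicator_of_notMem ht]
      exact zero_le
  have inner : ∀ z ∈ c.params, ∫⁻ w in c.params,
      ‖c.extQuot φ (c.lateral z, c.lateral w)‖ₑ ^ (2 : ℝ) ≤
        K * N * ∫⁻ t in c.line, G z.2 t := by
    intro z hz
    refine (setLIntegral_mono' hpm fun w hw => hquot φ hφ z hz w hw).trans ?_
    rw [lintegral_const_mul' _ _ hK, mul_assoc]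
    refine mul_le_mul' le_rfl ?_
    have e := lintegral_prod_mul (μ := volume.restrict (Ioo 0 (2 * Real.pi)))
      (ν := volume.restrict c.line)
      (f := fun θ' => ‖Real.sin ((z.1 - θ') / 2)‖ₑ ^ (-(1 / 2) : ℝ)) (g := G z.2)
      (Measurable.aemeasurable (by fun_prop)) (hGs z.2).aemeasurable
    rw [Measure.prod_restrict, ← Measure.volume_eq_prod] at e
    refine (le_of_eq e).trans ?_
    exact mul_le_mul' (ang z.1 hz.1) le_rfl
  have hmz : ∀ x : E3, Measurable fun y => ‖c.extQuot φ (x, y)‖ₑ ^ (2 : ℝ) := fun x =>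
    hm.comp measurable_prodMk_left
  rw [lintegral_prod _ hm.aemeasurable]
  refine (hsurf _ hm.lintegral_prod_right').trans ?_
  have s1 : ∫⁻ z in c.params, ∫⁻ y, ‖c.extQuot φ (c.lateral z, y)‖ₑ ^ (2 : ℝ) ∂c.surface ≤
      ∫⁻ z in c.params, C * (K * N * ∫⁻ t in c.line, G z.2 t) :=
    setLIntegral_mono' hpm fun z hz => (hsurf _ (hmz _)).trans (mul_le_mul' le_rfl (inner z hz))
  refine (mul_le_mul' le_rfl s1).trans ?_
  have hKN : K * N ≠ ∞ := by finiteness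
  rw [lintegral_const_mul' _ _ hC, lintegral_const_mul' _ _ hKN]
  have hHm : Measurable fun s => ∫⁻ t in c.line, G s t := hGm.lintegral_prod_right
  have e := lintegral_prod_mul (μ := volume.restrict (Ioo 0 (2 * Real.pi)))
      (ν := volume.restrict c.line) (f := fun _ => (1 : ℝ≥0∞))
      (g := fun s => ∫⁻ t in c.line, G s t) aemeasurable_const hHm.aemeasurable
  rw [Measure.prod_restrict, ← Measure.volume_eq_prod] at e
  simp only [one_mul, lintegral_const, Measure.restrict_apply_univ, Real.volume_Ioo,
    sub_zero] at e
  change C * (C * (K * N * ∫⁻ z in Ioo 0 (2 * Real.pi) ×ˢ c.line, _)) ≤ _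
  rw [e]
  refine (mul_le_mul' le_rfl (mul_le_mul' le_rfl (mul_le_mul' le_rfl
    (mul_le_mul' le_rfl (c.lintegral_kernel_le hDm))))).trans (le_of_eq ?_)
  ring

end Cylinder

namespace Cylinder

theorem qmp_axial (c : Cylinder) :
    Measure.QuasiMeasurePreserving c.axial c.surface (volume.restrict c.line) := by
  obtain ⟨C, -, hle⟩ := c.exists_map_axial_le
  exact ⟨c.continuous_axial.measurable, Measure.absolutelyContinuous_of_le_smul hle⟩

theorem exists_eLpNorm_comp_axial_le (c : Cylinder) : ∃ C : ℝ≥0∞, C ≠ ∞ ∧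
    ∀ v : Lp ℝ 2 (volume.restrict c.line), eLpNorm (fun x => v (c.axial x)) 2 c.surface ≤
      C * ‖v‖ₑ := by
  obtain ⟨C, hC, hle⟩ := c.exists_map_axial_le
  refine ⟨C ^ (1 / (2 : ℝ≥0∞).toReal), ENNReal.rpow_ne_top_of_nonneg (by simp) hC, fun v => ?_⟩
  have hmeas : AEStronglyMeasurable v (c.surface.map c.axial) :=
    (Lp.stronglyMeasurable v).aestronglyMeasurable
  have h := eLpNorm_map_measure (p := 2) hmeas c.continuous_axial.measurable.aemeasurable
  refine (le_of_eq h.symm).trans ((eLpNorm_mono_measure _ hle).trans (le_of_eq ?_))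
  rw [eLpNorm_smul_measure_of_ne_top (by simp), Lp.enorm_def, smul_eq_mul]
  simp

theorem memLp_comp_axial (c : Cylinder) (v : Lp ℝ 2 (volume.restrict c.line)) :
    MemLp (fun x => v (c.axial x)) 2 c.surface := by
  obtain ⟨C, hC, hle⟩ := c.exists_eLpNorm_comp_axial_le
  refine ⟨((Lp.stronglyMeasurable v).comp_measurable
    c.continuous_axial.measurable).aestronglyMeasurable, (hle v).trans_lt ?_⟩
  exact ENNReal.mul_lt_top hC.lt_top enorm_lt_top

theorem ae_fst (c : Cylinder) {P : ℝ → Prop} (h : ∀ᵐ s ∂(volume.restrict c.line), P s) :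
    ∀ᵐ p ∂(c.surface.prod c.surface), P (c.axial p.1) :=
  (c.qmp_axial.comp Measure.quasiMeasurePreserving_fst).ae h

theorem ae_snd (c : Cylinder) {P : ℝ → Prop} (h : ∀ᵐ s ∂(volume.restrict c.line), P s) :
    ∀ᵐ p ∂(c.surface.prod c.surface), P (c.axial p.2) :=
  (c.qmp_axial.comp Measure.quasiMeasurePreserving_snd).ae h

theorem exists_eLpNorm_extQuot_le (c : Cylinder) : ∃ C : ℝ≥0∞, C ≠ ∞ ∧ ∀ v : c.Vhat,
    eLpNorm (c.extQuot (c.val v)) 2 (c.surface.prod c.surface) ≤ C * ‖c.der v‖ₑ := by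
  obtain ⟨C, hC, hle⟩ := c.exists_lintegral_extQuot_le
  refine ⟨C ^ (1 / 2 : ℝ), ENNReal.rpow_ne_top_of_nonneg (by norm_num) hC, fun v => ?_⟩
  have htest : ∀ p ∈ testPairs c.line,
      eLpNorm (c.extQuot p.fst) 2 (c.surface.prod c.surface) ≤ C ^ (1 / 2 : ℝ) * ‖p.snd‖ₑ := by
    rintro p ⟨φ, hφ, h1, h2⟩
    have hcongr : c.extQuot p.fst =ᵐ[c.surface.prod c.surface] c.extQuot φ := by
      filter_upwards [c.ae_fst h1, c.ae_snd h1] with q a b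
      simp only [extQuot, a, b]
    rw [eLpNorm_congr_ae hcongr, Lp.enorm_def, eLpNorm_congr_ae h2,
      eLpNorm_eq_lintegral_rpow_enorm_toReal two_ne_zero ENNReal.ofNat_ne_top,
      eLpNorm_eq_lintegral_rpow_enorm_toReal two_ne_zero ENNReal.ofNat_ne_top]
    simp only [ENNReal.toReal_ofNat, gradient_eq_deriv']
    rw [← ENNReal.mul_rpow_of_nonneg _ _ (by norm_num)]
    exact ENNReal.rpow_le_rpow (hle φ hφ.1) (by norm_num)
  obtain ⟨p, hp, hlim⟩ := mem_closure_iff_seq_limit.1 v.2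
  have hfst : Tendsto (fun n => (p n).fst) atTop (𝓝 (c.val v)) :=
    ((WithLp.fstL 2 ℝ _ _).continuous.tendsto _).comp hlim
  have hsnd : Tendsto (fun n => (p n).snd) atTop (𝓝 (c.der v)) :=
    ((WithLp.sndL 2 ℝ _ _).continuous.tendsto _).comp hlim
  obtain ⟨ns, hns, hae⟩ := (tendstoInMeasure_of_tendsto_Lp hfst).exists_seq_tendsto_ae
  have hfatou := Lp.eLpNorm_lim_le_liminf_eLpNorm (p := 2) (μ := c.surface.prod c.surface)
    (f := fun n => c.extQuot (p (ns n)).fst)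
    (fun n => (c.measurable_extQuot
      (Lp.stronglyMeasurable (p (ns n)).fst).measurable).aestronglyMeasurable)
    (c.extQuot (c.val v)) (by
      filter_upwards [c.ae_fst hae, c.ae_snd hae] with q a b
      exact (a.sub b).div_const _)
  have hlim2 : Tendsto (fun n => C ^ (1 / 2 : ℝ) * ‖(p (ns n)).snd‖ₑ) atTop
      (𝓝 (C ^ (1 / 2 : ℝ) * ‖c.der v‖ₑ)) := by
    refine ENNReal.Tendsto.const_mul ?_
      (Or.inr (ENNReal.rpow_ne_top_of_nonneg (by norm_num) hC))
    exact ((continuous_enorm.tendsto _).comp hsnd).comp hns.tendsto_atTop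
  refine hfatou.trans ?_
  rw [← hlim2.liminf_eq]
  exact liminf_le_liminf (Eventually.of_forall fun n => htest _ (hp _))

theorem memLp_extQuot (c : Cylinder) (v : c.Vhat) :
    MemLp (c.extQuot (c.val v)) 2 (c.surface.prod c.surface) := by
  obtain ⟨C, hC, hle⟩ := c.exists_eLpNorm_extQuot_le
  refine ⟨(c.measurable_extQuot
    (Lp.stronglyMeasurable (c.val v)).measurable).aestronglyMeasurable, (hle v).trans_lt ?_⟩
  exact ENNReal.mul_lt_top hC.lt_top enorm_lt_top

/-- The space `H^{1/2}(Γ)`: square integrable functions `w` on `Γ` whose difference quotient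
`(w(x) - w(y)) / |x - y|^{3/2}` is square integrable on `Γ × Γ`. An element is the pair of `w` and
its difference quotient, so the inner product is the Sobolev–Slobodeckij one,
`(w, η)_{L²(Γ)} + ∫_Γ ∫_Γ (w(x) - w(y)) (η(x) - η(y)) / |x - y|³`. -/
def Hhalf (c : Cylinder) :
    Submodule ℝ (WithLp 2 (Lp ℝ 2 c.surface × Lp ℝ 2 (c.surface.prod c.surface))) where
  carrier := {w | w.snd =ᵐ[c.surface.prod c.surface]
    fun p => (w.fst p.1 - w.fst p.2) / ‖p.1 - p.2‖ ^ (3 / 2 : ℝ)}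
  zero_mem' := by
    have h := Lp.coeFn_zero ℝ 2 c.surface
    have h1 := Measure.quasiMeasurePreserving_fst (μ := c.surface) (ν := c.surface) |>.ae h
    have h2 := Measure.quasiMeasurePreserving_snd (μ := c.surface) (ν := c.surface) |>.ae h
    filter_upwards [h1, h2, Lp.coeFn_zero ℝ 2 (c.surface.prod c.surface)] with p a b d
    rw [WithLp.zero_fst, WithLp.zero_snd, a, b, d]
    simp
  add_mem' := by
    intro w η hw hη
    have h := Lp.coeFn_add w.fst η.fst
    have h1 := Measure.quasiMeasurePreserving_fst (μ := c.surface) (ν := c.surface) |>.ae h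
    have h2 := Measure.quasiMeasurePreserving_snd (μ := c.surface) (ν := c.surface) |>.ae h
    filter_upwards [hw, hη, h1, h2, Lp.coeFn_add w.snd η.snd] with p a b d e f
    rw [WithLp.add_fst, WithLp.add_snd, f, d, e, Pi.add_apply, Pi.add_apply, Pi.add_apply, a, b]
    ring
  smul_mem' := by
    intro k w hw
    have h := Lp.coeFn_smul k w.fst
    have h1 := Measure.quasiMeasurePreserving_fst (μ := c.surface) (ν := c.surface) |>.ae h
    have h2 := Measure.quasiMeasurePreserving_snd (μ := c.surface) (ν := c.surface) |>.ae h
    filter_upwards [hw, h1, h2, Lp.coeFn_smul k w.snd] with p a d e f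
    rw [WithLp.smul_fst, WithLp.smul_snd, f, d, e, Pi.smul_apply, Pi.smul_apply, Pi.smul_apply, a,
      smul_eq_mul, smul_eq_mul, smul_eq_mul]
    ring

instance instHhalfNormed (c : Cylinder) : NormedAddCommGroup c.Hhalf := Submodule.normedAddCommGroup _

instance instHhalfInner (c : Cylinder) : InnerProductSpace ℝ c.Hhalf := Submodule.innerProductSpace _

instance instHhalfSpace (c : Cylinder) : NormedSpace ℝ c.Hhalf := InnerProductSpace.toNormedSpace

/-- The space `𝓗^Γ`: the functions of `H^{1/2}(Γ)` that are constant on the boundary of each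
section, with value `v̂(s)` for some `v̂ ∈ V̂`; it carries the inner product of `H^{1/2}(Γ)`. -/
def HGamma (c : Cylinder) : Submodule ℝ c.Hhalf where
  carrier := {w | ∃ v : c.Vhat, w.1.fst =ᵐ[c.surface] fun x => c.val v (c.axial x)}
  zero_mem' := by
    refine ⟨0, ?_⟩
    have h := c.qmp_axial.ae (Lp.coeFn_zero ℝ 2 (volume.restrict c.line))
    filter_upwards [Lp.coeFn_zero ℝ 2 c.surface, h] with x a b
    rw [map_zero, b]
    exact a
  add_mem' := by
    rintro w η ⟨v, hv⟩ ⟨u, hu⟩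
    refine ⟨v + u, ?_⟩
    have h := c.qmp_axial.ae (Lp.coeFn_add (c.val v) (c.val u))
    filter_upwards [hv, hu, h, Lp.coeFn_add w.1.fst η.1.fst] with x a b d e
    rw [map_add, d, Pi.add_apply, ← a, ← b]
    exact e
  smul_mem' := by
    rintro k w ⟨v, hv⟩
    refine ⟨k • v, ?_⟩
    have h := c.qmp_axial.ae (Lp.coeFn_smul k (c.val v))
    filter_upwards [hv, h, Lp.coeFn_smul k w.1.fst] with x a d e
    rw [map_smul, d, Pi.smul_apply, ← a]
    exact e

instance instHGammaNormed (c : Cylinder) : NormedAddCommGroup c.HGamma := Submodule.normedAddCommGroup _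

instance instHGammaInner (c : Cylinder) : InnerProductSpace ℝ c.HGamma := Submodule.innerProductSpace _

instance instHGammaSpace (c : Cylinder) : NormedSpace ℝ c.HGamma := InnerProductSpace.toNormedSpace

/-- The extension of `v̂ ∈ V̂` to `Γ`, as an element of `𝓗^Γ`. -/
def extFun (c : Cylinder) (v : c.Vhat) : c.HGamma :=
  ⟨⟨WithLp.toLp 2 ((c.memLp_comp_axial (c.val v)).toLp, (c.memLp_extQuot v).toLp), by
    have h1 := Measure.quasiMeasurePreserving_fst (μ := c.surface) (ν := c.surface) |>.ae
      (c.memLp_comp_axial (c.val v)).coeFn_toLp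
    have h2 := Measure.quasiMeasurePreserving_snd (μ := c.surface) (ν := c.surface) |>.ae
      (c.memLp_comp_axial (c.val v)).coeFn_toLp
    filter_upwards [h1, h2, (c.memLp_extQuot v).coeFn_toLp] with p a b d
    refine d.trans ?_
    simp only [extQuot]
    rw [← a, ← b]
    rfl⟩, v, (c.memLp_comp_axial (c.val v)).coeFn_toLp⟩

/-- The extension operator `E_Γ : V̂ → 𝓗^Γ` as a linear map. -/
def extLinear (c : Cylinder) : c.Vhat →ₗ[ℝ] c.HGamma where
  toFun := c.extFun
  map_add' := by
    intro u v
    have h := Lp.coeFn_add (c.val u) (c.val v)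
    apply Subtype.ext
    apply Subtype.ext
    apply WithLp.ofLp_injective
    refine Prod.ext ?_ ?_
    · change (c.memLp_comp_axial (c.val (u + v))).toLp = (c.memLp_comp_axial (c.val u)).toLp +
        (c.memLp_comp_axial (c.val v)).toLp
      rw [← MemLp.toLp_add]
      apply MemLp.toLp_congr
      filter_upwards [c.qmp_axial.ae h] with x hx
      rw [map_add, hx]
      rfl
    · change (c.memLp_extQuot (u + v)).toLp = (c.memLp_extQuot u).toLp + (c.memLp_extQuot v).toLp
      rw [← MemLp.toLp_add]
      apply MemLp.toLp_congr
      filter_upwards [c.ae_fst h, c.ae_snd h] with p a b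
      simp only [extQuot, Pi.add_apply]
      rw [map_add, a, b, Pi.add_apply, Pi.add_apply]
      ring
  map_smul' := by
    intro k u
    have h := Lp.coeFn_smul k (c.val u)
    apply Subtype.ext
    apply Subtype.ext
    apply WithLp.ofLp_injective
    refine Prod.ext ?_ ?_
    · change (c.memLp_comp_axial (c.val (k • u))).toLp =
        k • (c.memLp_comp_axial (c.val u)).toLp
      rw [← MemLp.toLp_const_smul]
      apply MemLp.toLp_congr
      filter_upwards [c.qmp_axial.ae h] with x hx
      rw [map_smul, hx]
      rfl
    · change (c.memLp_extQuot (k • u)).toLp = k • (c.memLp_extQuot u).toLp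
      rw [← MemLp.toLp_const_smul]
      apply MemLp.toLp_congr
      filter_upwards [c.ae_fst h, c.ae_snd h] with p a b
      simp only [extQuot, Pi.smul_apply, smul_eq_mul]
      rw [map_smul, a, b, Pi.smul_apply, Pi.smul_apply, smul_eq_mul, smul_eq_mul]
      ring

theorem exists_extLinear_le (c : Cylinder) : ∃ C : ℝ, ∀ v : c.Vhat, ‖c.extLinear v‖ ≤ C * ‖v‖ := by
  obtain ⟨C1, hC1, h1⟩ := c.exists_eLpNorm_comp_axial_le
  obtain ⟨C2, hC2, h2⟩ := c.exists_eLpNorm_extQuot_le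
  refine ⟨√(C1.toReal ^ 2 + C2.toReal ^ 2), fun v => ?_⟩
  have a1 : ‖(c.memLp_comp_axial (c.val v)).toLp‖ ≤ C1.toReal * ‖c.val v‖ := by
    rw [Lp.norm_toLp, ← toReal_enorm (c.val v), ← ENNReal.toReal_mul]
    exact ENNReal.toReal_mono (ENNReal.mul_ne_top hC1 enorm_ne_top) (h1 _)
  have a2 : ‖(c.memLp_extQuot v).toLp‖ ≤ C2.toReal * ‖c.der v‖ := by
    rw [Lp.norm_toLp, ← toReal_enorm (c.der v), ← ENNReal.toReal_mul]
    exact ENNReal.toReal_mono (ENNReal.mul_ne_top hC2 enorm_ne_top) (h2 _)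
  have e : ‖c.extLinear v‖ ^ 2 = ‖(c.memLp_comp_axial (c.val v)).toLp‖ ^ 2 +
      ‖(c.memLp_extQuot v).toLp‖ ^ 2 :=
    WithLp.prod_norm_sq_eq_of_L2 (c.extLinear v).1.1
  have ev : ‖v‖ ^ 2 = ‖c.val v‖ ^ 2 + ‖c.der v‖ ^ 2 := WithLp.prod_norm_sq_eq_of_L2 v.1
  refine (sq_le_sq₀ (norm_nonneg _) (by positivity)).1 ?_
  rw [mul_pow, Real.sq_sqrt (by positivity)]
  refine (le_of_eq e).trans ((?_ : _ ≤ _).trans (le_of_eq (congrArg _ ev.symm)))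
  have b1 := pow_le_pow_left₀ (norm_nonneg _) a1 2
  have b2 := pow_le_pow_left₀ (norm_nonneg _) a2 2
  rw [mul_pow] at b1 b2
  nlinarith [mul_nonneg (sq_nonneg C1.toReal) (sq_nonneg ‖c.der v‖),
    mul_nonneg (sq_nonneg C2.toReal) (sq_nonneg ‖c.val v‖)]

/-- The extension operator `E_Γ : V̂ → 𝓗^Γ`, `(E_Γ v̂)(x) = v̂(s)` for `x ∈ Γ(s)`. -/
def ext (c : Cylinder) : c.Vhat →L[ℝ] c.HGamma :=
  c.extLinear.mkContinuousOfExistsBound c.exists_extLinear_le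

/-- The `L²(Γ)` function underlying an element of `𝓗^Γ`. -/
def surfaceVal (c : Cylinder) : c.HGamma →L[ℝ] Lp ℝ 2 c.surface :=
  (WithLp.fstL 2 ℝ _ _).comp (c.Hhalf.subtypeL.comp c.HGamma.subtypeL)

theorem surfaceVal_ext (c : Cylinder) (v : c.Vhat) :
    c.surfaceVal (c.ext v) =ᵐ[c.surface] fun x => c.val v (c.axial x) :=
  (c.memLp_comp_axial (c.val v)).coeFn_toLp

end Cylinder

/-! ### The coupled problem -/

/-- The bulk domain `Ω`, bounded, open and convex, with an embedded cylinder `Σ` whose closed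
sections lie in `Ω`, except for the two extreme ones, which lie on the boundary of `Ω`. -/
structure Domain extends Cylinder where
  Ω : Set E3
  isOpen : IsOpen Ω
  isBounded : Bornology.IsBounded Ω
  convex : Convex ℝ Ω
  inside : ∀ s ∈ Ioo 0 S, ∀ r ∈ Icc (0 : ℝ) 1, ∀ θ, toCylinder.point r θ s ∈ Ω
  ends₀ : ∀ r ∈ Icc (0 : ℝ) 1, ∀ θ, toCylinder.point r θ 0 ∈ frontier Ω
  endsS : ∀ r ∈ Icc (0 : ℝ) 1, ∀ θ, toCylinder.point r θ S ∈ frontier Ω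

namespace Domain

/-- The triples `(φ, ∇φ, φ|_Γ)` with `φ` a test function on `Ω`. -/
def testTraces (d : Domain) : Submodule ℝ (SobolevPair d.Ω × Lp ℝ 2 d.surface) where
  carrier := {q | ∃ φ : E3 → ℝ, IsTest d.Ω φ ∧ q.1.fst =ᵐ[volume.restrict d.Ω] φ ∧
    q.1.snd =ᵐ[volume.restrict d.Ω] ∇ φ ∧ q.2 =ᵐ[d.surface] φ}
  zero_mem' := by
    refine ⟨fun _ => 0, IsTest.zero _, Lp.coeFn_zero _ _ _, ?_, Lp.coeFn_zero _ _ _⟩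
    have : ∇ (fun _ : E3 => (0 : ℝ)) = fun _ => 0 := by
      funext x
      simp [gradient]
    rw [this]
    exact Lp.coeFn_zero _ _ _
  add_mem' := by
    rintro p r ⟨φ, hφ, h1, h2, h5⟩ ⟨η, hη, h3, h4, h6⟩
    refine ⟨_, hφ.add hη, ?_, ?_, ?_⟩
    · filter_upwards [h1, h3, Lp.coeFn_add p.1.fst r.1.fst] with x a b c
      rw [Prod.fst_add, WithLp.add_fst, c, Pi.add_apply, a, b]
    · filter_upwards [h2, h4, Lp.coeFn_add p.1.snd r.1.snd] with x a b c
      rw [Prod.fst_add, WithLp.add_snd, c, Pi.add_apply, a, b, hφ.gradient_add hη]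
    · filter_upwards [h5, h6, Lp.coeFn_add p.2 r.2] with x a b c
      rw [Prod.snd_add, c, Pi.add_apply, a, b]
  smul_mem' := by
    rintro c p ⟨φ, hφ, h1, h2, h3⟩
    refine ⟨_, hφ.smul c, ?_, ?_, ?_⟩
    · filter_upwards [h1, Lp.coeFn_smul c p.1.fst] with x a b
      rw [Prod.smul_fst, WithLp.smul_fst, b, Pi.smul_apply, a, smul_eq_mul]
    · filter_upwards [h2, Lp.coeFn_smul c p.1.snd] with x a b
      rw [Prod.smul_fst, WithLp.smul_snd, b, Pi.smul_apply, a, hφ.gradient_smul]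
    · filter_upwards [h3, Lp.coeFn_smul c p.2] with x a b
      rw [Prod.smul_snd, b, Pi.smul_apply, a, smul_eq_mul]

/-- The graph of the trace operator `v ↦ v|_Γ` on `H¹₀(Ω)`: the closure, in `H¹(Ω) × L²(Γ)`, of
the graph of the restriction of test functions to `Γ`. -/
def traceGraph (d : Domain) : Submodule ℝ (SobolevPair d.Ω × Lp ℝ 2 d.surface) :=
  d.testTraces.topologicalClosure

/-- The product `H¹₀(Ω) × V̂`, with the norm `(‖v‖²_{H¹(Ω)} + ‖v̌‖²_{H¹(Λ)})^{1/2}`. -/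
def Ambient (d : Domain) : Type := WithLp 2 (H10 d.Ω × d.Vhat)

instance instAmbientNormed (d : Domain) : NormedAddCommGroup d.Ambient :=
  inferInstanceAs (NormedAddCommGroup (WithLp 2 (H10 d.Ω × d.Vhat)))

instance instAmbientInner (d : Domain) : InnerProductSpace ℝ d.Ambient :=
  inferInstanceAs (InnerProductSpace ℝ (WithLp 2 (H10 d.Ω × d.Vhat)))

/-- The first projection `(v, v̌) ↦ v`. -/
def left (d : Domain) : d.Ambient →L[ℝ] H10 d.Ω := WithLp.fstL 2 ℝ (H10 d.Ω) d.Vhat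

/-- The second projection `(v, v̌) ↦ v̌`. -/
def right (d : Domain) : d.Ambient →L[ℝ] d.Vhat := WithLp.sndL 2 ℝ (H10 d.Ω) d.Vhat

/-- The map `(v, v̌) ↦ (v, E_Γ v̌)`. -/
def withExt (d : Domain) : d.Ambient →L[ℝ] SobolevPair d.Ω × Lp ℝ 2 d.surface :=
  ((H10 d.Ω).subtypeL.comp d.left).prod ((d.surfaceVal.comp d.ext).comp d.right)

/-- The space `V` of the functions `v ∈ H¹₀(Ω)` whose trace on `Γ` belongs to `𝓗^Γ`, that is,
`v|_Γ = E_Γ v̌` for some `v̌ ∈ V̂`. An element is the pair of `v` and the function `v̌`, which is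
determined by `v`; the norm is `(‖v‖²_{H¹(Ω)} + ‖v̌‖²_{H¹(Λ)})^{1/2}`. -/
def V (d : Domain) : Submodule ℝ d.Ambient :=
  d.traceGraph.comap d.withExt.toLinearMap

instance instVNormed (d : Domain) : NormedAddCommGroup d.V := Submodule.normedAddCommGroup _

instance instVInner (d : Domain) : InnerProductSpace ℝ d.V := Submodule.innerProductSpace _

instance instVSpace (d : Domain) : NormedSpace ℝ d.V := InnerProductSpace.toNormedSpace

/-- The function `v ∈ L²(Ω)` underlying an element of `V`. -/
def fn (d : Domain) : d.V →L[ℝ] Lp ℝ 2 (volume.restrict d.Ω) :=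
  (WithLp.fstL 2 ℝ _ _).comp ((H10 d.Ω).subtypeL.comp (d.left.comp d.V.subtypeL))

/-- The gradient `∇v ∈ L²(Ω; ℝ³)` of an element of `V`. -/
def grad (d : Domain) : d.V →L[ℝ] Lp E3 2 (volume.restrict d.Ω) :=
  (WithLp.sndL 2 ℝ _ _).comp ((H10 d.Ω).subtypeL.comp (d.left.comp d.V.subtypeL))

/-- The function `v̌ ∈ V̂` with `γ_Γ v = E_Γ v̌`. -/
def check (d : Domain) : d.V →L[ℝ] d.Vhat := d.right.comp d.V.subtypeL

/-- The trace operator `γ_Γ : V → 𝓗^Γ`. -/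
def trace (d : Domain) : d.V →L[ℝ] d.HGamma := d.ext.comp d.check

theorem trace_mem (d : Domain) (v : d.V) :
    ((d.left v.1 : SobolevPair d.Ω), d.surfaceVal (d.trace v)) ∈ d.traceGraph := v.2

end Domain

/-- The coefficients and the sources of the coupled problem. The source `g` on `Σ` is regular enough
for its section means to be defined and square integrable. -/
structure Coefficients (d : Domain) where
  K : E3 → E3 →L[ℝ] E3
  K_bdd : MemLp K ∞ (volume.restrict d.Ω)
  K_pos : ∃ k > 0, ∀ᵐ x ∂(volume.restrict d.Ω), ∀ ξ, k * ‖ξ‖ ^ 2 ≤ ⟪K x ξ, ξ⟫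
  Ktilde : ℝ → ℝ
  Ktilde_bdd : MemLp Ktilde ∞ (volume.restrict d.line)
  Ktilde_pos : ∃ k > 0, ∀ᵐ s ∂(volume.restrict d.line), k ≤ Ktilde s
  f : E3 → ℝ
  f_mem : MemLp f 2 (volume.restrict d.Ω)
  g : E3 → ℝ
  g_int : ∀ᵐ s ∂(volume.restrict d.line), IntegrableOn
    (fun z : ℝ × ℝ => g (d.point z.1 z.2 s) * z.1) (Ioo (0 : ℝ) 1 ×ˢ Ioo 0 (2 * Real.pi))
  g_mem : MemLp (d.sectionMean g) 2 (volume.restrict d.line)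
  α : ℝ
  α_pos : 0 < α
  αhat : ℝ
  αhat_pos : 0 < αhat

/-- The adjoint `T* : Y' → X'` of `T : X → Y`. -/
def adjoint {X Y : Type*} [NormedAddCommGroup X] [NormedSpace ℝ X] [NormedAddCommGroup Y]
    [NormedSpace ℝ Y] (T : X →L[ℝ] Y) : StrongDual ℝ Y →L[ℝ] StrongDual ℝ X :=
  ContinuousLinearMap.precomp ℝ T

/-- The adjoint `T* : Y → X'` of `T : X → Y'`, `⟨T* y, x⟩ = ⟨T x, y⟩`. -/
def adjointToDual {X Y : Type*} [NormedAddCommGroup X] [NormedSpace ℝ X] [NormedAddCommGroup Y]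
    [NormedSpace ℝ Y] (T : X →L[ℝ] StrongDual ℝ Y) : Y →L[ℝ] StrongDual ℝ X :=
  T.flip

/-- The adjoint `T* : Y → H` of `T : H' → Y'`, with `H'' = H` for a Hilbert space `H`. -/
def adjointOfDual {H Y : Type*} [NormedAddCommGroup H] [InnerProductSpace ℝ H] [CompleteSpace H]
    [NormedAddCommGroup Y] [NormedSpace ℝ Y] (T : StrongDual ℝ H →L[ℝ] StrongDual ℝ Y) (y : Y) :
    H :=
  (InnerProductSpace.toDual ℝ H).symm ((T.flip y).comp (innerForm H))

theorem adjointOfDual_spec {H Y : Type*} [NormedAddCommGroup H] [InnerProductSpace ℝ H]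
    [CompleteSpace H] [NormedAddCommGroup Y] [NormedSpace ℝ Y]
    (T : StrongDual ℝ H →L[ℝ] StrongDual ℝ Y) (y : Y) (φ : StrongDual ℝ H) :
    φ (adjointOfDual T y) = T φ y := by
  obtain ⟨w, rfl⟩ := (InnerProductSpace.toDual ℝ H).surjective φ
  rw [InnerProductSpace.toDual_apply_apply, real_inner_comm, adjointOfDual,
    InnerProductSpace.toDual_symm_apply]
  rfl

namespace Coefficients

/-- `⟨A u, v⟩ = (K ∇u, ∇v) + α (|Γ| ǔ, v̌)`. -/
def A {d : Domain} (c : Coefficients d) : d.V →L[ℝ] StrongDual ℝ d.V :=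
  (innerForm (Lp E3 2 (volume.restrict d.Ω))).bilinearComp
      ((tensorMul c.K c.K_bdd).comp d.grad) d.grad +
    c.α • (innerForm (Lp ℝ 2 (volume.restrict d.line))).bilinearComp
      ((scalarMul d.perimeter d.memLp_perimeter).comp (d.val.comp d.check)) (d.val.comp d.check)

/-- `⟨Â û, v̂⟩ = (K̃ |Σ| dû/ds, dv̂/ds) + α̂ (|Γ| û, v̂)`. -/
def Ahat {d : Domain} (c : Coefficients d) : d.Vhat →L[ℝ] StrongDual ℝ d.Vhat :=
  (innerForm (Lp ℝ 2 (volume.restrict d.line))).bilinearComp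
      ((scalarMul c.Ktilde c.Ktilde_bdd).comp
        ((scalarMul d.sectionArea d.memLp_sectionArea).comp d.der)) d.der +
    c.αhat • (innerForm (Lp ℝ 2 (volume.restrict d.line))).bilinearComp
      ((scalarMul d.perimeter d.memLp_perimeter).comp d.val) d.val

/-- `⟨B φ, v⟩ = ⟨|Γ| φ, v̌⟩ = ⟨φ, |Γ| v̌⟩`. -/
def B {d : Domain} (_c : Coefficients d) : StrongDual ℝ d.Vhat →L[ℝ] StrongDual ℝ d.V :=
  ContinuousLinearMap.precomp ℝ (d.perimeterMul.comp d.check)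

/-- `⟨B̂ φ, v̂⟩ = ⟨|Γ| φ, v̂⟩ = ⟨φ, |Γ| v̂⟩`. -/
def Bhat {d : Domain} (_c : Coefficients d) : StrongDual ℝ d.Vhat →L[ℝ] StrongDual ℝ d.Vhat :=
  ContinuousLinearMap.precomp ℝ d.perimeterMul

/-- `⟨C ψ̂, v⟩ = α (|Γ| ψ̂, v̌)`. -/
def C {d : Domain} (c : Coefficients d) : d.Vhat →L[ℝ] StrongDual ℝ d.V :=
  c.α • (innerForm (Lp ℝ 2 (volume.restrict d.line))).bilinearComp
    ((scalarMul d.perimeter d.memLp_perimeter).comp d.val) (d.val.comp d.check)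

/-- `⟨Ĉ ψ̂, v̂⟩ = α̂ (|Γ| ψ̂, v̂)`. -/
def Chat {d : Domain} (c : Coefficients d) : d.Vhat →L[ℝ] StrongDual ℝ d.Vhat :=
  c.αhat • (innerForm (Lp ℝ 2 (volume.restrict d.line))).bilinearComp
    ((scalarMul d.perimeter d.memLp_perimeter).comp d.val) d.val

/-- `F(v) = (f, v)`. -/
def F {d : Domain} (c : Coefficients d) : StrongDual ℝ d.V :=
  (innerForm (Lp ℝ 2 (volume.restrict d.Ω)) c.f_mem.toLp).comp d.fn

/-- `G(v̂) = (|Σ| ḡ, v̂)`, with `ḡ` the section mean of `g`. -/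
def G {d : Domain} (c : Coefficients d) : StrongDual ℝ d.Vhat :=
  (innerForm (Lp ℝ 2 (volume.restrict d.line))
    (scalarMul d.sectionArea d.memLp_sectionArea c.g_mem.toLp)).comp d.val

theorem A_apply {d : Domain} (c : Coefficients d) (u v : d.V) :
    c.A u v = (∫ x in d.Ω, ⟪c.K x (d.grad u x), d.grad v x⟫) +
      c.α * ∫ s in d.line, d.perimeter s * d.val (d.check u) s * d.val (d.check v) s := by
  have h1 : c.A u v = ⟪tensorMul c.K c.K_bdd (d.grad u), d.grad v⟫ +
    c.α * ⟪scalarMul d.perimeter d.memLp_perimeter (d.val (d.check u)), d.val (d.check v)⟫ := rfl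
  rw [h1, L2.inner_def, L2.inner_def]
  congr 1
  · apply integral_congr_ae
    filter_upwards [tensorMul_coe c.K c.K_bdd (d.grad u)] with x hx
    rw [hx]
  · congr 1
    apply integral_congr_ae
    filter_upwards [scalarMul_coe d.perimeter d.memLp_perimeter (d.val (d.check u))] with x hx
    rw [hx]
    exact mul_comm _ _

theorem Ahat_apply {d : Domain} (c : Coefficients d) (u v : d.Vhat) :
    c.Ahat u v = (∫ s in d.line, c.Ktilde s * d.sectionArea s * d.der u s * d.der v s) +
      c.αhat * ∫ s in d.line, d.perimeter s * d.val u s * d.val v s := by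
  have h1 : c.Ahat u v = ⟪scalarMul c.Ktilde c.Ktilde_bdd
      (scalarMul d.sectionArea d.memLp_sectionArea (d.der u)), d.der v⟫ +
    c.αhat * ⟪scalarMul d.perimeter d.memLp_perimeter (d.val u), d.val v⟫ := rfl
  rw [h1, L2.inner_def, L2.inner_def]
  congr 1
  · apply integral_congr_ae
    filter_upwards [scalarMul_coe c.Ktilde c.Ktilde_bdd
      (scalarMul d.sectionArea d.memLp_sectionArea (d.der u)),
      scalarMul_coe d.sectionArea d.memLp_sectionArea (d.der u)] with x hx hy
    have e : ⟪scalarMul c.Ktilde c.Ktilde_bdd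
        (scalarMul d.sectionArea d.memLp_sectionArea (d.der u)) x, d.der v x⟫ =
        scalarMul c.Ktilde c.Ktilde_bdd
          (scalarMul d.sectionArea d.memLp_sectionArea (d.der u)) x * d.der v x := mul_comm _ _
    rw [e, hx, hy]
    ring
  · congr 1
    apply integral_congr_ae
    filter_upwards [scalarMul_coe d.perimeter d.memLp_perimeter (d.val u)] with x hx
    rw [hx]
    exact mul_comm _ _

/-- The stabilized problems `A u - B φ - C ψ̂ = F` and `Â û + B̂ φ - Ĉ ψ̂ = G`: the pair `(u, û)` is
the state that corresponds to the controls `(φ, ψ̂)`. -/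
def IsState {d : Domain} (c : Coefficients d) (φ : StrongDual ℝ d.Vhat) (ψ : d.Vhat) (u : d.V)
    (uhat : d.Vhat) : Prop :=
  c.A u - c.B φ - c.C ψ = c.F ∧ c.Ahat uhat + c.Bhat φ - c.Chat ψ = c.G

/-- The admissible quadruples `(φ, ψ̂, u, û)`: controls with their state. -/
def admissible {d : Domain} (c : Coefficients d) :
    Set (StrongDual ℝ d.Vhat × d.Vhat × d.V × d.Vhat) :=
  {x | c.IsState x.1 x.2.1 x.2.2.1 x.2.2.2}

/-- The adjoint problem `A* p = γ_Γ* Θ (γ_Γ u - E_Γ ψ̂)`, with `Θ` the Riesz map of `𝓗^Γ`. -/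
def IsAdjointState {d : Domain} (c : Coefficients d) (ψ : d.Vhat) (u : d.V) (p : d.V) : Prop :=
  adjointToDual c.A p =
    adjoint d.trace (InnerProductSpace.toDualMap ℝ d.HGamma (d.trace u - d.ext ψ))

/-- The adjoint problem `Â* p̂ = E_Γ* Θ (E_Γ û - E_Γ ψ̂)`. -/
def IsAdjointStateHat {d : Domain} (c : Coefficients d) (ψ uhat : d.Vhat) (phat : d.Vhat) : Prop :=
  adjointToDual c.Ahat phat =
    adjoint d.ext (InnerProductSpace.toDualMap ℝ d.HGamma (d.ext uhat - d.ext ψ))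

/-- `Θ_V̂ (B* p - B̂* p̂) ∈ V̂'`, with `Θ_V̂ : V̂ → V̂'` the Riesz isomorphism. -/
def gradPhi {d : Domain} (c : Coefficients d) (p : d.V) (phat : d.Vhat) : StrongDual ℝ d.Vhat :=
  InnerProductSpace.toDual ℝ d.Vhat (adjointOfDual c.B p - adjointOfDual c.Bhat phat)

/-- `Θ_V̂⁻¹ (C* p + Ĉ* p̂ - E_Γ* Θ (γ_Γ u + E_Γ û - 2 E_Γ ψ̂)) ∈ V̂`. -/
def gradPsi {d : Domain} (c : Coefficients d) (ψ : d.Vhat) (u : d.V) (uhat : d.Vhat) (p : d.V)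
    (phat : d.Vhat) : d.Vhat :=
  (InnerProductSpace.toDual ℝ d.Vhat).symm
    (adjointToDual c.C p + adjointToDual c.Chat phat -
      adjoint d.ext (InnerProductSpace.toDualMap ℝ d.HGamma
        (d.trace u + d.ext uhat - (2 : ℝ) • d.ext ψ)))

end Coefficients

/-- The cost `½ (‖γ_Γ u - E_Γ ψ̂‖² + ‖E_Γ û - E_Γ ψ̂‖²)`, with norms in `𝓗^Γ`, of the quadruple
`(φ, ψ̂, u, û)`; on the admissible quadruples this is `J(φ, ψ̂)`. -/
def cost (d : Domain) (x : StrongDual ℝ d.Vhat × d.Vhat × d.V × d.Vhat) : ℝ :=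
  1 / 2 * (‖d.trace x.2.2.1 - d.ext x.2.1‖ ^ 2 + ‖d.ext x.2.2.2 - d.ext x.2.1‖ ^ 2)

/-- The linear form `(δφ, δψ̂, δu, δû) ↦ (a, δφ)_{V̂'} + (b, δψ̂)_V̂`, which only involves the
controls; the inner product of `V̂'` is `(a, δφ)_{V̂'} = ⟨δφ, Θ_V̂⁻¹ a⟩`. -/
def controlForm (d : Domain) (a : StrongDual ℝ d.Vhat) (b : d.Vhat) :
    (StrongDual ℝ d.Vhat × d.Vhat × d.V × d.Vhat) →L[ℝ] ℝ :=
  (NormedSpace.inclusionInDoubleDual ℝ d.Vhat ((InnerProductSpace.toDual ℝ d.Vhat).symm a)).comp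
      (ContinuousLinearMap.fst ℝ _ _) +
    (innerForm d.Vhat b).comp
      ((ContinuousLinearMap.fst ℝ _ _).comp (ContinuousLinearMap.snd ℝ _ _))

theorem controlForm_apply (d : Domain) (a : StrongDual ℝ d.Vhat) (b : d.Vhat)
    (x : StrongDual ℝ d.Vhat × d.Vhat × d.V × d.Vhat) :
    controlForm d a b x = ⟪(InnerProductSpace.toDual ℝ d.Vhat).symm a,
      (InnerProductSpace.toDual ℝ d.Vhat).symm x.1⟫ + ⟪b, x.2.1⟫ := by
  rw [real_inner_comm, InnerProductSpace.toDual_symm_apply]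
  rfl

end Coupled3D1D

end

noncomputable section

namespace Coupled3D1D

/-! ### Poincaré inequalities and weak derivatives -/

/-! The whole proposition turns on the fact that the minimum of the cost is zero. If `û = ψ̂ = ǔ`,
both residuals vanish, the reaction terms of `A` and `Â` cancel against `C` and `Ĉ`, and the line
equation tested with `v̌`, added to the bulk equation, loses the flux `φ`. What remains is one
problem on `V`, with the form `(K∇u, ∇v) + (K̃|Σ| ǔ', v̌')` and the right-hand side `F(v) + G(v̌)`.
The Poincaré inequalities in `Ω` and on the centreline make this form coercive for the norm of `V`,
which contains the full `H¹` norm of `ǔ` (`isCoercive_coupledForm`), so Lax–Milgram gives `u`. The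
flux is then read off the line equation, because multiplication by `|Γ|` is bounded below on `V̂`
and its transpose is therefore onto `V̂'` (`exists_precomp_perimeterMul_eq`). Hence an admissible
quadruple of cost zero exists (`exists_cost_eq_zero`), and it is optimal.

Conversely, every optimal quadruple has cost zero, so the right-hand sides of both adjoint equations
vanish. By uniqueness `p = 0` and `p̂ = 0`, and both gradient expressions are zero (`optimality`).

Uniqueness has two sources. `Â` is coercive on `V̂`, which also gives existence of `p̂`. `A` is only
shown to be definite: `A(u, u)` contains `∇u` and `ǔ` but no derivative of `ǔ`, so `A(u, u) = 0`
gives `u = 0` by the Poincaré inequality and the uniqueness of weak derivatives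
(`eq_zero_of_A_apply_self`), and no existence is drawn from it.

The derivative formula is a duality identity. Differences of admissible quadruples solve the state
equations without sources; pairing these with `p, p̂`, and the adjoint equations with the state
increments, removes the states from the derivative of the quadratic cost
(`inner_add_inner_eq_controlForm`). -/

theorem H10.norm_fst_le {E : Type*} [NormedAddCommGroup E] [InnerProductSpace ℝ E]
    [CompleteSpace E] [MeasureSpace E] {U : Set E} {C : ℝ≥0∞} (hC : C ≠ ∞)
    (h : ∀ φ : E → ℝ, IsTest U φ → eLpNorm φ 2 (volume.restrict U) ≤
      C * eLpNorm (∇ φ) 2 (volume.restrict U))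
    {p : SobolevPair U} (hp : p ∈ H10 U) : ‖p.fst‖ ≤ C.toReal * ‖p.snd‖ := by
  -- The inequality is a closed condition on pairs, so it passes from test functions to their
  -- closure.
  have hclosed : IsClosed {p : SobolevPair U | ‖p.fst‖ ≤ C.toReal * ‖p.snd‖} :=
    isClosed_le (WithLp.fstL 2 ℝ _ _).continuous.norm
      (continuous_const.mul (WithLp.sndL 2 ℝ _ _).continuous.norm)
  refine closure_minimal ?_ hclosed hp
  rintro p ⟨φ, hφ, h1, h2⟩
  have := h φ hφ
  rw [← eLpNorm_congr_ae h1, ← eLpNorm_congr_ae h2, ← Lp.enorm_def, ← Lp.enorm_def] at this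
  have := ENNReal.toReal_mono (ENNReal.mul_ne_top hC enorm_ne_top) this
  rwa [ENNReal.toReal_mul, toReal_enorm, toReal_enorm] at this

/-- The Poincaré inequality in a bounded set of `ℝ³`. -/
theorem exists_poincare_of_isBounded {U : Set E3} (hU : Bornology.IsBounded U) :
    ∃ C : ℝ, 0 ≤ C ∧ ∀ p ∈ H10 U, ‖p.fst‖ ≤ C * ‖p.snd‖ := by
  refine ⟨_, ENNReal.toReal_nonneg, fun p hp => H10.norm_fst_le (C :=
    (eLpNormLESNormFDerivOfLeConst ℝ (volume : Measure E3) U 2 2 : ℝ≥0∞))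
    ENNReal.coe_ne_top (fun φ hφ => ?_) hp⟩
  have hsupp : Function.support φ ⊆ U := (subset_tsupport φ).trans hφ.2.2
  -- The Gagliardo–Nirenberg–Sobolev inequality on a bounded set with both exponents equal to 2. It
  -- needs `2 < 3`, the dimension; the interval below is therefore treated by a different argument.
  have h := eLpNorm_le_eLpNorm_fderiv (volume : Measure E3) hφ.1 hsupp (p := 2) (by norm_num)
    (by rw [finrank_euclideanSpace_fin]; norm_num) hU
  have hnorm : ∀ x, ‖∇ φ x‖ = ‖fderiv ℝ φ x‖ := fun x => by simp [gradient]
  -- The Sobolev inequality is stated over all of `ℝ³`; since the gradient vanishes off `U`, its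
  -- norm there is the norm over `U`.
  have hgrad : Function.support (∇ φ) ⊆ U := by
    intro x hx
    refine hφ.2.2 (tsupport_fderiv_subset ℝ (subset_tsupport _ ?_))
    rw [Function.mem_support] at hx ⊢
    rwa [← norm_ne_zero_iff, ← hnorm, norm_ne_zero_iff]
  rw [eLpNorm_restrict_eq_of_support_subset hgrad, eLpNorm_congr_norm_ae (.of_forall hnorm)]
  exact (eLpNorm_restrict_le _ _ _ _).trans h

/-- The Poincaré inequality in a bounded interval. -/
theorem exists_poincare_Ioo (S : ℝ) :
    ∃ C : ℝ, 0 ≤ C ∧ ∀ p ∈ H10 (Ioo 0 S), ‖p.fst‖ ≤ C * ‖p.snd‖ := by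
  refine ⟨_, ENNReal.toReal_nonneg, fun p hp => H10.norm_fst_le (C := ENNReal.ofReal S)
    ENNReal.ofReal_ne_top (fun φ hφ => ?_) hp⟩
  -- The endpoint `0` is outside the open interval, so every value of `φ` is an increment from `0`,
  -- to which the Cauchy–Schwarz bound for increments applies.
  have h0 : φ 0 = 0 := image_eq_zero_of_notMem_tsupport fun h => lt_irrefl _ (hφ.2.2 h).1
  set I : ℝ≥0∞ := ∫⁻ x in Ioo 0 S, ‖deriv φ x‖ₑ ^ (2 : ℝ) with hI
  have hpt : ∀ s ∈ Ioo 0 S, ‖φ s‖ₑ ^ (2 : ℝ) ≤ ENNReal.ofReal S * I := by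
    intro s hs
    have h := enorm_sub_sq_le hφ.1 s 0
    rw [h0, sub_zero, sub_zero, uIoc_of_le hs.1.le] at h
    refine h.trans (mul_le_mul' ?_ (lintegral_mono_set fun x hx => ⟨hx.1, hx.2.trans_lt hs.2⟩))
    rw [Real.enorm_eq_ofReal hs.1.le]
    exact ENNReal.ofReal_le_ofReal hs.2.le
  -- Integrating the pointwise bound over an interval of length `S` produces the second factor `S`;
  -- after the square root the Poincaré constant is `S`.
  have hint : ∫⁻ s in Ioo 0 S, ‖φ s‖ₑ ^ (2 : ℝ) ≤ ENNReal.ofReal S ^ (2 : ℝ) * I := by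
    refine (setLIntegral_mono' measurableSet_Ioo hpt).trans (le_of_eq ?_)
    rw [lintegral_const, Measure.restrict_apply_univ, Real.volume_Ioo, sub_zero]
    norm_num
    ring
  rw [eLpNorm_eq_lintegral_rpow_enorm_toReal two_ne_zero ENNReal.ofNat_ne_top,
    eLpNorm_eq_lintegral_rpow_enorm_toReal two_ne_zero ENNReal.ofNat_ne_top]
  simp only [ENNReal.toReal_ofNat, gradient_eq_deriv']
  refine (ENNReal.rpow_le_rpow hint (by norm_num)).trans (le_of_eq ?_)
  rw [ENNReal.mul_rpow_of_nonneg _ _ (by norm_num), ← ENNReal.rpow_mul]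
  norm_num [hI]

/-- Weak derivatives are unique. -/
theorem H10.snd_eq_zero_of_fst_eq_zero {a b : ℝ} {p : SobolevPair (Ioo a b)}
    (hp : p ∈ H10 (Ioo a b)) (h0 : p.fst = 0) : p.snd = 0 := by
  have orth : ∀ η : ℝ → ℝ, IsTest (Ioo a b) η → ∫ x in Ioo a b, η x * p.snd x = 0 := by
    intro η hη
    have m1 : MemLp η 2 (volume.restrict (Ioo a b)) :=
      (hη.1.continuous.memLp_of_hasCompactSupport hη.2.1).restrict _
    have m2 : MemLp (deriv η) 2 (volume.restrict (Ioo a b)) :=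
      ((hη.1.continuous_deriv le_rfl).memLp_of_hasCompactSupport hη.2.1.deriv).restrict _
    -- Integration by parts against a fixed `η` is a closed linear relation between a function and
    -- its derivative, so it survives the passage to the closure of the test functions.
    have key : ⟪m1.toLp, p.snd⟫ + ⟪m2.toLp, p.fst⟫ = 0 := by
      have hclosed : IsClosed {p : SobolevPair (Ioo a b) |
          ⟪m1.toLp, p.snd⟫ + ⟪m2.toLp, p.fst⟫ = 0} :=
        isClosed_eq ((continuous_const.inner (WithLp.sndL 2 ℝ _ _).continuous).add
          (continuous_const.inner (WithLp.fstL 2 ℝ _ _).continuous)) continuous_const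
      refine closure_minimal ?_ hclosed hp
      rintro q ⟨φ, hφ, h1, h2⟩
      -- Both integrands vanish off the interval, so the integrals may be taken over the whole line,
      -- where integration by parts has no boundary terms.
      have e1 : ⟪m1.toLp, q.snd⟫ = ∫ x, η x * deriv φ x := by
        refine (L2.inner_def _ _).trans (Eq.trans ?_
          (setIntegral_eq_integral_of_forall_compl_eq_zero (s := Ioo a b) ?_))
        · apply integral_congr_ae
          filter_upwards [m1.coeFn_toLp, h2] with x u v
          rw [u, v, gradient_eq_deriv']
          exact mul_comm _ _
        · intro x hx
          rw [image_eq_zero_of_notMem_tsupport fun h => hx (hη.2.2 h), zero_mul]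
      have e2 : ⟪m2.toLp, q.fst⟫ = ∫ x, deriv η x * φ x := by
        refine (L2.inner_def _ _).trans (Eq.trans ?_
          (setIntegral_eq_integral_of_forall_compl_eq_zero (s := Ioo a b) ?_))
        · apply integral_congr_ae
          filter_upwards [m2.coeFn_toLp, h1] with x u v
          rw [u, v]
          exact mul_comm _ _
        · intro x hx
          rw [image_eq_zero_of_notMem_tsupport fun h => hx (hφ.2.2 h), mul_zero]
      have c1 := hη.1.continuous
      have c2 := hφ.1.continuous
      have c3 := hη.1.continuous_deriv le_rfl
      have c4 := hφ.1.continuous_deriv le_rfl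
      have e3 := integral_mul_deriv_eq_deriv_mul_of_integrable (u := η) (v := φ)
        (u' := deriv η) (v' := deriv φ)
        (fun x _ => (hη.1.differentiable one_ne_zero x).hasDerivAt)
        (fun x _ => (hφ.1.differentiable one_ne_zero x).hasDerivAt)
        ((c1.mul c4).integrable_of_hasCompactSupport hη.2.1.mul_right)
        ((c3.mul c2).integrable_of_hasCompactSupport hφ.2.1.mul_left)
        ((c1.mul c2).integrable_of_hasCompactSupport hη.2.1.mul_right)
      change ⟪m1.toLp, q.snd⟫ + ⟪m2.toLp, q.fst⟫ = 0
      rw [e1, e2, e3, neg_add_cancel]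
    rw [h0, inner_zero_right, add_zero, L2.inner_def] at key
    rw [← key]
    apply integral_congr_ae
    filter_upwards [m1.coeFn_toLp] with x u
    rw [u]
    exact mul_comm _ _
  -- The interval has finite measure, so `L²` functions are integrable on it and the fundamental
  -- lemma of the calculus of variations applies.
  have hint : IntegrableOn p.snd (Ioo a b) := (Lp.memLp p.snd).integrable one_le_two
  have hae := isOpen_Ioo.ae_eq_zero_of_integral_contDiff_smul_eq_zero
    hint.locallyIntegrableOn fun η h1 h2 h3 => by
      rw [← orth η ⟨h1.of_le (by simp), h2, h3⟩,
        ← setIntegral_eq_integral_of_forall_compl_eq_zero (s := Ioo a b)]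
      · rfl
      · intro x hx
        rw [image_eq_zero_of_notMem_tsupport fun h => hx (h3 h), zero_smul]
  rw [Lp.eq_zero_iff_ae_eq_zero]
  exact (ae_restrict_iff' measurableSet_Ioo).2 hae

/-! ### Lower bounds for multiplication operators, and the Lax–Milgram theorem -/

theorem le_inner_of_ae_le {α : Type*} [MeasurableSpace α] {μ : Measure α} {F : Type*}
    [NormedAddCommGroup F] [InnerProductSpace ℝ F] {m : ℝ} {u w : Lp F 2 μ}
    (h : ∀ᵐ x ∂μ, m * ‖u x‖ ^ 2 ≤ ⟪w x, u x⟫) : m * ‖u‖ ^ 2 ≤ ⟪w, u⟫ := by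
  rw [← real_inner_self_eq_norm_sq, L2.inner_def, L2.inner_def, ← integral_const_mul]
  refine integral_mono_ae ((L2.integrable_inner u u).const_mul m) (L2.integrable_inner w u) ?_
  filter_upwards [h] with x hx
  rwa [real_inner_self_eq_norm_sq]

theorem le_inner_scalarMul {α : Type*} [MeasurableSpace α] {μ : Measure α} {k : α → ℝ}
    (hk : MemLp k ∞ μ) {m : ℝ} (h : ∀ᵐ x ∂μ, m ≤ k x) (u : Lp ℝ 2 μ) :
    m * ‖u‖ ^ 2 ≤ ⟪scalarMul k hk u, u⟫ := by
  apply le_inner_of_ae_le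
  filter_upwards [h, scalarMul_coe k hk u] with x a b
  rw [b, Real.norm_eq_abs, sq_abs]
  have e : ⟪k x * u x, u x⟫ = k x * u x ^ 2 := by
    change u x * (k x * u x) = _
    ring
  rw [e]
  exact mul_le_mul_of_nonneg_right a (sq_nonneg _)

/-- Cauchy–Schwarz applied to the quadratic bound, divided by `‖u‖`. -/
theorem le_norm_scalarMul {α : Type*} [MeasurableSpace α] {μ : Measure α} {k : α → ℝ}
    (hk : MemLp k ∞ μ) {m : ℝ} (h : ∀ᵐ x ∂μ, m ≤ k x) (u : Lp ℝ 2 μ) :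
    m * ‖u‖ ≤ ‖scalarMul k hk u‖ := by
  have h1 := (le_inner_scalarMul hk h u).trans (real_inner_le_norm _ _)
  rcases (norm_nonneg u).eq_or_lt with h0 | h0
  · rw [← h0, mul_zero]
    exact norm_nonneg _
  · rw [pow_two, ← mul_assoc] at h1
    exact le_of_mul_le_mul_right h1 h0

/-- The existence half of Lax–Milgram, in terms of functionals rather than Riesz representatives. No
symmetry of the form is required, which matters because `K` need not be symmetric. -/
theorem exists_eq_of_isCoercive {V : Type*} [NormedAddCommGroup V] [InnerProductSpace ℝ V]
    [CompleteSpace V] {B : V →L[ℝ] StrongDual ℝ V} (hB : IsCoercive B) (ℓ : StrongDual ℝ V) :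
    ∃ u, B u = ℓ := by
  obtain ⟨u, hu⟩ := hB.continuousLinearEquivOfBilin.surjective
    ((InnerProductSpace.toDual ℝ V).symm ℓ)
  refine ⟨u, ContinuousLinearMap.ext fun v => ?_⟩
  rw [← hB.continuousLinearEquivOfBilin_apply, hu, InnerProductSpace.toDual_symm_apply]

theorem eq_of_isCoercive {V : Type*} [NormedAddCommGroup V] [InnerProductSpace ℝ V]
    {B : V →L[ℝ] StrongDual ℝ V} (hB : IsCoercive B) {u v : V} (h : B u = B v) : u = v := by
  obtain ⟨C, hC, hle⟩ := hB
  have h1 := hle (u - v)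
  have h0 : B (u - v) = 0 := by rw [map_sub, h, sub_self]
  rw [h0, zero_apply, mul_assoc] at h1
  have h2 : ‖u - v‖ * ‖u - v‖ ≤ 0 := nonpos_of_mul_nonpos_right h1 hC
  have h3 : ‖u - v‖ = 0 := mul_self_eq_zero.1 (le_antisymm h2 (mul_self_nonneg _))
  exact sub_eq_zero.1 (norm_eq_zero.1 h3)

/-! ### The centreline: the space `V̂` and multiplication by the perimeter -/

namespace Cylinder

instance completeSpace_Vhat (c : Cylinder) : CompleteSpace c.Vhat :=
  (Submodule.isClosed_topologicalClosure _).completeSpace_coe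

theorem norm_sq_Vhat (c : Cylinder) (v : c.Vhat) : ‖v‖ ^ 2 = ‖c.val v‖ ^ 2 + ‖c.der v‖ ^ 2 :=
  WithLp.prod_norm_sq_eq_of_L2 v.1

/-- An element of `V̂` is a pair; uniqueness of weak derivatives makes its second component depend
on the first. This is what turns `L²` information on `ǔ` into information in `V̂`. -/
theorem eq_zero_of_val_eq_zero (c : Cylinder) {v : c.Vhat} (h : c.val v = 0) : v = 0 := by
  have h' : c.der v = 0 := H10.snd_eq_zero_of_fst_eq_zero v.2 h
  have := c.norm_sq_Vhat v
  rw [h, h'] at this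
  simpa using this

theorem perimeter_pos (c : Cylinder) {s : ℝ} (hs : s ∈ Icc 0 c.S) : 0 < c.perimeter s := by
  have h := c.continuous_dTheta
  apply intervalIntegral.intervalIntegral_pos_of_pos
  · exact Continuous.intervalIntegrable (by fun_prop) _ _
  · exact fun θ => norm_pos_iff.2 (c.dTheta_ne_zero hs θ)
  · exact Real.two_pi_pos

theorem sectionArea_pos (c : Cylinder) {s : ℝ} (hs : s ∈ Icc 0 c.S) : 0 < c.sectionArea s := by
  have h1 := norm_pos_iff.2 (c.semi₁_ne s hs)
  have h2 := norm_pos_iff.2 (c.semi₂_ne s hs)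
  have := Real.pi_pos
  unfold sectionArea
  positivity

/-- The minimum is taken over the closed interval; for the perimeter and the area it is positive
because the end sections are non-degenerate too. -/
theorem exists_ae_le_of_pos (c : Cylinder) {k : ℝ → ℝ} (hk : Continuous k)
    (hpos : ∀ s ∈ Icc 0 c.S, 0 < k s) :
    ∃ m > 0, ∀ᵐ s ∂(volume.restrict c.line), m ≤ k s := by
  obtain ⟨s, hs, hmin⟩ := isCompact_Icc.exists_isMinOn ⟨0, le_rfl, c.S_pos.le⟩ hk.continuousOn
  refine ⟨k s, hpos s hs, ?_⟩
  filter_upwards [ae_restrict_mem measurableSet_Ioo] with t ht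
  exact hmin (Ioo_subset_Icc_self ht)

theorem perimeterMul_der (c : Cylinder) (v : c.Vhat) :
    c.der (c.perimeterMul v) = scalarMul c.perimeter c.memLp_perimeter (c.der v) +
      scalarMul c.perimeterDeriv c.memLp_perimeterDeriv (c.val v) := rfl

/-- Since `|Γ| ≥ m > 0`, the product `|Γ| v` controls `v`; by the product rule `|Γ| v' = (|Γ| v)' -
|Γ|' v` it then controls `v'` as well, `|Γ|'` being bounded. -/
theorem exists_le_norm_perimeterMul (c : Cylinder) :
    ∃ m > 0, ∀ v : c.Vhat, m * ‖v‖ ^ 2 ≤ ‖c.perimeterMul v‖ ^ 2 := by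
  obtain ⟨m, hm, hle⟩ := c.exists_ae_le_of_pos c.continuous_perimeter fun s => c.perimeter_pos
  set D := ‖scalarMul c.perimeterDeriv c.memLp_perimeterDeriv‖ with hD
  have hD0 : 0 ≤ D := norm_nonneg _
  -- With `t = D / m`, the bounds `m x ≤ X` and `m y ≤ Y + t X` give `m²(x² + y²) ≤ (1 + 2t²) X² +
  -- 2Y²`, which is at most `2(1 + 2t²)(X² + Y²)`.
  refine ⟨(m ^ 2 / 2) / (1 + 2 * (D / m) ^ 2), by positivity, fun v => ?_⟩
  set x := ‖c.val v‖
  set y := ‖c.der v‖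
  set X := ‖c.val (c.perimeterMul v)‖
  set Y := ‖c.der (c.perimeterMul v)‖
  have h1 : m * x ≤ X := le_norm_scalarMul c.memLp_perimeter hle (c.val v)
  have h2 : m * y ≤ Y + D * x := by
    refine (le_norm_scalarMul c.memLp_perimeter hle (c.der v)).trans ?_
    rw [← sub_eq_of_eq_add (c.perimeterMul_der v)]
    exact (norm_sub_le _ _).trans
      (add_le_add_right (ContinuousLinearMap.le_opNorm _ _) _)
  have hx : 0 ≤ x := norm_nonneg _
  have hy : 0 ≤ y := norm_nonneg _
  have hX : 0 ≤ X := norm_nonneg _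
  have hY : 0 ≤ Y := norm_nonneg _
  rw [c.norm_sq_Vhat, c.norm_sq_Vhat, div_mul_eq_mul_div, div_le_iff₀ (by positivity)]
  set t := D / m with ht
  have hDx : D * x ≤ t * X := by
    have : D * x = t * (m * x) := by
      rw [ht]
      field_simp
    rw [this]
    exact mul_le_mul_of_nonneg_left h1 (by positivity)
  have q1 : (m * x) ^ 2 ≤ X ^ 2 := pow_le_pow_left₀ (by positivity) h1 2
  have q2 : (m * y) ^ 2 ≤ (Y + t * X) ^ 2 :=
    pow_le_pow_left₀ (by positivity) (h2.trans (by linarith)) 2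
  nlinarith [sq_nonneg (Y - t * X), mul_nonneg (sq_nonneg t) (sq_nonneg Y), sq_nonneg X]

/-- Transposed multiplication by the perimeter is onto `V̂'`. -/
theorem exists_precomp_perimeterMul_eq (c : Cylinder) (ℓ : StrongDual ℝ c.Vhat) :
    ∃ φ : StrongDual ℝ c.Vhat, φ.comp c.perimeterMul = ℓ := by
  obtain ⟨m, hm, hle⟩ := c.exists_le_norm_perimeterMul
  -- Lax–Milgram for the form `(|Γ| v, |Γ| w)` on `V̂`: if `w` solves it with right-hand side `ℓ`,
  -- then `φ = (|Γ| w, ·)` is the required functional, and no division by `|Γ|` is needed.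
  have hB : IsCoercive ((innerForm c.Vhat).bilinearComp c.perimeterMul c.perimeterMul) := by
    refine ⟨m, hm, fun v => ?_⟩
    have e : (innerForm c.Vhat).bilinearComp c.perimeterMul c.perimeterMul v v =
      ‖c.perimeterMul v‖ ^ 2 := real_inner_self_eq_norm_sq (c.perimeterMul v)
    rw [e, mul_assoc, ← pow_two]
    exact hle v
  obtain ⟨w, hw⟩ := exists_eq_of_isCoercive hB ℓ
  exact ⟨innerForm c.Vhat (c.perimeterMul w), hw⟩

end Cylinder

/-! ### Completeness and norm of `V` -/

namespace Domain

instance completeSpace_Ambient (d : Domain) : CompleteSpace d.Ambient :=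
  haveI : CompleteSpace (H10 d.Ω) :=
    (Submodule.isClosed_topologicalClosure _).completeSpace_coe
  inferInstanceAs (CompleteSpace (WithLp 2 (H10 d.Ω × d.Vhat)))

/-- The trace graph is closed by construction and `V` is its preimage under a continuous map.
Completeness is what Lax–Milgram needs for the reduced problem. -/
instance completeSpace_V (d : Domain) : CompleteSpace d.V := by
  have h : IsClosed (d.V : Set d.Ambient) :=
    (Submodule.isClosed_topologicalClosure d.testTraces).preimage d.withExt.continuous
  exact h.completeSpace_coe

theorem norm_sq_V (d : Domain) (v : d.V) :
    ‖v‖ ^ 2 = ‖d.fn v‖ ^ 2 + ‖d.grad v‖ ^ 2 + ‖d.check v‖ ^ 2 := by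
  have h1 : ‖v‖ ^ 2 = ‖d.left v.1‖ ^ 2 + ‖d.check v‖ ^ 2 :=
    WithLp.prod_norm_sq_eq_of_L2 (show WithLp 2 (H10 d.Ω × d.Vhat) from v.1)
  have h2 : ‖d.left v.1‖ ^ 2 = ‖d.fn v‖ ^ 2 + ‖d.grad v‖ ^ 2 :=
    WithLp.prod_norm_sq_eq_of_L2 (d.left v.1).1
  rw [h1, h2]

theorem exists_norm_fn_le (d : Domain) : ∃ C : ℝ, 0 ≤ C ∧ ∀ v : d.V, ‖d.fn v‖ ≤ C * ‖d.grad v‖ := by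
  obtain ⟨C, h0, hC⟩ := exists_poincare_of_isBounded d.isBounded
  exact ⟨C, h0, fun v => hC _ (d.left v.1).2⟩

end Domain

/-! ### Adjoints and derivatives in abstract spaces -/

/-- The Fréchet derivative of the squared norm of a pair of differences of linear maps. -/
theorem hasFDerivAt_half_norm_sq_add {X H : Type*} [NormedAddCommGroup X]
    [NormedSpace ℝ X] [NormedAddCommGroup H] [InnerProductSpace ℝ H] (P Q : X →L[ℝ] H) (x : X) :
    HasFDerivAt (fun x => 1 / 2 * (‖P x‖ ^ 2 + ‖Q x‖ ^ 2))
      ((innerForm H (P x)).comp P + (innerForm H (Q x)).comp Q) x := by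
  have h := ((P.hasFDerivAt (x := x)).norm_sq.add (Q.hasFDerivAt (x := x)).norm_sq).const_mul
    (1 / 2 : ℝ)
  refine h.congr_fderiv (ContinuousLinearMap.ext fun v => ?_)
  simp [innerForm_apply]

/-- Only the values on the increments within `s` of a derivative relative to `s` matter. -/
theorem hasFDerivWithinAt_congr_of_eq_on_sub {X Y : Type*} [NormedAddCommGroup X]
    [NormedSpace ℝ X] [NormedAddCommGroup Y] [NormedSpace ℝ Y] {f : X → Y} {L L' : X →L[ℝ] Y}
    {s : Set X} {x : X} (h : HasFDerivWithinAt f L s x) (hL : ∀ y ∈ s, L (y - x) = L' (y - x)) :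
    HasFDerivWithinAt f L' s x := by
  rw [hasFDerivWithinAt_iff_isLittleO] at h ⊢
  refine h.congr' ?_ EventuallyEq.rfl
  filter_upwards [self_mem_nhdsWithin] with y hy
  rw [hL y hy]

theorem adjointOfDual_zero {H Y : Type*} [NormedAddCommGroup H]
    [InnerProductSpace ℝ H] [CompleteSpace H] [NormedAddCommGroup Y] [NormedSpace ℝ Y]
    (T : StrongDual ℝ H →L[ℝ] StrongDual ℝ Y) : adjointOfDual T 0 = 0 := by
  simp [adjointOfDual]

theorem add_sub_two_smul {G : Type*} [AddCommGroup G] [Module ℝ G] (a b c : G) :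
    a + b - (2 : ℝ) • c = (a - c) + (b - c) := by
  rw [two_smul]
  abel

/-- With primes for increments, the derivative of the cost is split into the right-hand sides of the
two adjoint equations, tested with the state increments, and a remainder in the increment of `ψ̂`,
which is the last term of `gradPsi`. -/
theorem inner_sub_add_inner_sub {G : Type*} [NormedAddCommGroup G] [InnerProductSpace ℝ G]
    (a b c a' b' c' : G) : ⟪a - c, a' - c'⟫ + ⟪b - c, b' - c'⟫ =
      ⟪a - c, a'⟫ + ⟪b - c, b'⟫ - ⟪a + b - (2 : ℝ) • c, c'⟫ := by
  rw [add_sub_two_smul, inner_add_left, inner_sub_right, inner_sub_right]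
  ring

/-- The left side of `hL` is the unrestricted derivative of the quadratic functional at `y - x`.
Since agreement is asked only for `y ∈ s`, a form in the controls alone can replace a derivative
that involves the states. -/
theorem hasFDerivWithinAt_half_norm_sq_add {X₁ X₂ X₃ X₄ G : Type*} [NormedAddCommGroup X₁]
    [NormedSpace ℝ X₁] [NormedAddCommGroup X₂] [NormedSpace ℝ X₂] [NormedAddCommGroup X₃]
    [NormedSpace ℝ X₃] [NormedAddCommGroup X₄] [NormedSpace ℝ X₄] [NormedAddCommGroup G]
    [InnerProductSpace ℝ G] (T₂ : X₂ →L[ℝ] G) (T₃ : X₃ →L[ℝ] G) (T₄ : X₄ →L[ℝ] G)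
    (s : Set (X₁ × X₂ × X₃ × X₄)) (x : X₁ × X₂ × X₃ × X₄) (L : (X₁ × X₂ × X₃ × X₄) →L[ℝ] ℝ)
    (hL : ∀ y ∈ s, ⟪T₃ x.2.2.1 - T₂ x.2.1, T₃ (y.2.2.1 - x.2.2.1) - T₂ (y.2.1 - x.2.1)⟫ +
      ⟪T₄ x.2.2.2 - T₂ x.2.1, T₄ (y.2.2.2 - x.2.2.2) - T₂ (y.2.1 - x.2.1)⟫ =
        L (y.1 - x.1, y.2.1 - x.2.1, y.2.2.1 - x.2.2.1, y.2.2.2 - x.2.2.2)) :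
    HasFDerivWithinAt (fun x => 1 / 2 * (‖T₃ x.2.2.1 - T₂ x.2.1‖ ^ 2 +
      ‖T₄ x.2.2.2 - T₂ x.2.1‖ ^ 2)) L s x := by
  let pr : (X₁ × X₂ × X₃ × X₄) →L[ℝ] X₃ × X₄ :=
    (ContinuousLinearMap.snd ℝ _ _).comp (ContinuousLinearMap.snd ℝ _ _)
  let S : (X₁ × X₂ × X₃ × X₄) →L[ℝ] G := T₂.comp
    ((ContinuousLinearMap.fst ℝ _ _).comp (ContinuousLinearMap.snd ℝ _ _))
  exact hasFDerivWithinAt_congr_of_eq_on_sub (hasFDerivAt_half_norm_sq_add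
    (T₃.comp ((ContinuousLinearMap.fst ℝ _ _).comp pr) - S)
    (T₄.comp ((ContinuousLinearMap.snd ℝ _ _).comp pr) - S) x).hasFDerivWithinAt hL

/-- The arithmetic of the duality argument: `a₁, a₂` stand for `A` and `Â` at the state increments
and the adjoint states, `x₁, x₂` for the adjoint right-hand sides, and `b`, `c` for the
contributions of the increments of `φ` and `ψ̂`. -/
theorem eq_of_eq_add_sub {i k x₁ x₂ a₁ a₂ b₁ b₂ c₁ c₂ y : ℝ} (hi : i = x₁ + x₂ - y) (h₁ : a₁ = x₁)
    (h₂ : a₂ = x₂) (h₁' : a₁ = b₁ + c₁) (h₂' : a₂ = c₂ - b₂)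
    (hk : k = b₁ - b₂ + (c₁ + c₂ - y)) : i = k := by
  linarith

/-! ### Definiteness and coercivity of the forms -/

namespace Coefficients

variable {d : Domain} (c : Coefficients d)

/-- The diffusion form `(K ∇u, ∇v)` in the bulk. -/
def bulkForm : d.V →L[ℝ] StrongDual ℝ d.V :=
  (innerForm (Lp E3 2 (volume.restrict d.Ω))).bilinearComp
    ((tensorMul c.K c.K_bdd).comp d.grad) d.grad

/-- The diffusion form `(K̃ |Σ| dû/ds, dv̂/ds)` on the centreline. -/
def lineForm : d.Vhat →L[ℝ] StrongDual ℝ d.Vhat :=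
  (innerForm (Lp ℝ 2 (volume.restrict d.line))).bilinearComp
    ((scalarMul c.Ktilde c.Ktilde_bdd).comp
      ((scalarMul d.sectionArea d.memLp_sectionArea).comp d.der)) d.der

/-- The form of the reduced problem, in which `û = ǔ` and the flux is eliminated. -/
def coupledForm : d.V →L[ℝ] StrongDual ℝ d.V :=
  c.bulkForm + c.lineForm.bilinearComp d.check d.check

theorem bulkForm_apply (u v : d.V) :
    c.bulkForm u v = ⟪tensorMul c.K c.K_bdd (d.grad u), d.grad v⟫ := rfl

theorem lineForm_apply (u v : d.Vhat) : c.lineForm u v = ⟪scalarMul c.Ktilde c.Ktilde_bdd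
    (scalarMul d.sectionArea d.memLp_sectionArea (d.der u)), d.der v⟫ := rfl

theorem coupledForm_apply (u v : d.V) :
    c.coupledForm u v = c.bulkForm u v + c.lineForm (d.check u) (d.check v) := rfl

theorem C_apply (u : d.Vhat) (v : d.V) : c.C u v =
    c.α * ⟪scalarMul d.perimeter d.memLp_perimeter (d.val u), d.val (d.check v)⟫ := rfl

theorem Chat_apply (u v : d.Vhat) : c.Chat u v =
    c.αhat * ⟪scalarMul d.perimeter d.memLp_perimeter (d.val u), d.val v⟫ := rfl

/-- The reaction term of `A` is `C` applied to `ǔ`, so `A u - C ψ̂` reduces to pure diffusion when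
`ψ̂ = ǔ`. The next identity does the same for `Â`. -/
theorem A_eq_bulkForm_add (u v : d.V) : c.A u v = c.bulkForm u v + c.C (d.check u) v := rfl

theorem Ahat_eq_lineForm_add (u : d.Vhat) : c.Ahat u = c.lineForm u + c.Chat u := rfl

theorem exists_le_bulkForm : ∃ k > 0, ∀ u : d.V, k * ‖d.grad u‖ ^ 2 ≤ c.bulkForm u u := by
  obtain ⟨k, hk, hle⟩ := c.K_pos
  refine ⟨k, hk, fun u => ?_⟩
  rw [bulkForm_apply]
  apply le_inner_of_ae_le
  filter_upwards [hle, tensorMul_coe c.K c.K_bdd (d.grad u)] with x a b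
  exact (a _).trans (le_of_eq (by rw [b]))

theorem exists_le_lineForm : ∃ k > 0, ∀ u : d.Vhat, k * ‖d.der u‖ ^ 2 ≤ c.lineForm u u := by
  obtain ⟨k, hk, hle⟩ := c.Ktilde_pos
  obtain ⟨m, hm, hle'⟩ := d.exists_ae_le_of_pos d.continuous_sectionArea fun s => d.sectionArea_pos
  refine ⟨k * m, mul_pos hk hm, fun u => ?_⟩
  rw [lineForm_apply]
  apply le_inner_of_ae_le
  filter_upwards [hle, hle', scalarMul_coe d.sectionArea d.memLp_sectionArea (d.der u),
    scalarMul_coe c.Ktilde c.Ktilde_bdd (scalarMul d.sectionArea d.memLp_sectionArea (d.der u))]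
    with x a b e f
  have g : ⟪(scalarMul c.Ktilde c.Ktilde_bdd)
      (scalarMul d.sectionArea d.memLp_sectionArea (d.der u)) x, d.der u x⟫ =
      c.Ktilde x * d.sectionArea x * d.der u x ^ 2 := by
    rw [f, e]
    change d.der u x * (c.Ktilde x * (d.sectionArea x * d.der u x)) = _
    ring
  refine le_trans ?_ (le_of_eq g.symm)
  rw [Real.norm_eq_abs, sq_abs]
  exact mul_le_mul_of_nonneg_right (mul_le_mul a b hm.le (hk.le.trans a)) (sq_nonneg _)

theorem exists_le_Chat : ∃ k > 0, ∀ u : d.Vhat, k * ‖d.val u‖ ^ 2 ≤ c.Chat u u := by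
  obtain ⟨m, hm, hle⟩ := d.exists_ae_le_of_pos d.continuous_perimeter fun s => d.perimeter_pos
  refine ⟨c.αhat * m, mul_pos c.αhat_pos hm, fun u => ?_⟩
  rw [Chat_apply, mul_assoc]
  exact mul_le_mul_of_nonneg_left (le_inner_scalarMul d.memLp_perimeter hle (d.val u)) c.αhat_pos.le

theorem exists_le_C : ∃ k > 0, ∀ u : d.V, k * ‖d.val (d.check u)‖ ^ 2 ≤ c.C (d.check u) u := by
  obtain ⟨m, hm, hle⟩ := d.exists_ae_le_of_pos d.continuous_perimeter fun s => d.perimeter_pos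
  refine ⟨c.α * m, mul_pos c.α_pos hm, fun u => ?_⟩
  rw [C_apply, mul_assoc]
  exact mul_le_mul_of_nonneg_left
    (le_inner_scalarMul d.memLp_perimeter hle (d.val (d.check u))) c.α_pos.le

/-- Both parts of `A(u, u)` are nonnegative, so `∇u` and the `L²` function `ǔ` vanish; the Poincaré
inequality then removes `u`, and uniqueness of weak derivatives removes the derivative of `ǔ`, which
occurs in the norm of `V` but not in `A`. -/
theorem eq_zero_of_A_apply_self {u : d.V} (h : c.A u u = 0) : u = 0 := by
  obtain ⟨k, hk, h1⟩ := c.exists_le_bulkForm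
  obtain ⟨m, hm, h2⟩ := c.exists_le_C
  obtain ⟨P, -, hP⟩ := d.exists_norm_fn_le
  have h1 := h1 u
  have h2 := h2 u
  rw [A_eq_bulkForm_add] at h
  have p1 : 0 ≤ k * ‖d.grad u‖ ^ 2 := by positivity
  have p2 : 0 ≤ m * ‖d.val (d.check u)‖ ^ 2 := by positivity
  have e1 : ‖d.grad u‖ = 0 := by
    have : k * ‖d.grad u‖ ^ 2 = 0 := by linarith
    simpa [hk.ne'] using this
  have e2 : d.val (d.check u) = 0 := by
    have : m * ‖d.val (d.check u)‖ ^ 2 = 0 := by linarith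
    simpa [hm.ne'] using this
  have e3 : ‖d.fn u‖ = 0 := le_antisymm (by simpa [e1] using hP u) (norm_nonneg _)
  have := d.norm_sq_V u
  rw [e1, e3, d.eq_zero_of_val_eq_zero e2] at this
  simpa using this

theorem isCoercive_Ahat : IsCoercive c.Ahat := by
  obtain ⟨k, hk, h1⟩ := c.exists_le_lineForm
  obtain ⟨m, hm, h2⟩ := c.exists_le_Chat
  refine ⟨min k m, lt_min hk hm, fun u => ?_⟩
  rw [mul_assoc, ← pow_two, d.norm_sq_Vhat, Ahat_eq_lineForm_add, add_apply]
  have := h1 u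
  have := h2 u
  nlinarith [mul_le_mul_of_nonneg_right (min_le_left k m) (sq_nonneg ‖d.der u‖),
    mul_le_mul_of_nonneg_right (min_le_right k m) (sq_nonneg ‖d.val u‖)]

/-- Coercivity concerns only the diagonal, which transposition leaves unchanged. -/
theorem isCoercive_flip_Ahat : IsCoercive c.Ahat.flip := by
  obtain ⟨k, hk, h⟩ := c.isCoercive_Ahat
  exact ⟨k, hk, fun u => (h u).trans (le_of_eq (ContinuousLinearMap.flip_apply _ _ _).symm)⟩

/-- The line form supplies the derivative of `ǔ` that `A` lacks, and the two Poincaré inequalities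
supply the `L²` norms of `u` and `ǔ`; no reaction term is needed. -/
theorem isCoercive_coupledForm : IsCoercive c.coupledForm := by
  obtain ⟨k, hk, h1⟩ := c.exists_le_bulkForm
  obtain ⟨m, hm, h2⟩ := c.exists_le_lineForm
  obtain ⟨P, hP0, hP⟩ := d.exists_norm_fn_le
  obtain ⟨Q, hQ0, hQ⟩ := exists_poincare_Ioo d.S
  -- The denominators absorb the Poincaré constants: `‖u‖² + ‖∇u‖² ≤ (P² + 1)‖∇u‖²`, and likewise on
  -- the line with `Q`.
  refine ⟨min (k / (P ^ 2 + 1)) (m / (Q ^ 2 + 1)), lt_min (by positivity) (by positivity),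
    fun u => ?_⟩
  set t := min (k / (P ^ 2 + 1)) (m / (Q ^ 2 + 1)) with ht
  have t0 : 0 < t := lt_min (by positivity) (by positivity)
  have t1 : t * (P ^ 2 + 1) ≤ k := (le_div_iff₀ (by positivity)).1 (min_le_left _ _)
  have t2 : t * (Q ^ 2 + 1) ≤ m := (le_div_iff₀ (by positivity)).1 (min_le_right _ _)
  rw [mul_assoc, ← pow_two, d.norm_sq_V, d.norm_sq_Vhat, coupledForm_apply]
  have h1 := h1 u
  have h2 := h2 (d.check u)
  have h3 := pow_le_pow_left₀ (norm_nonneg _) (hP u) 2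
  have h4 : ‖d.val (d.check u)‖ ^ 2 ≤ (Q * ‖d.der (d.check u)‖) ^ 2 :=
    pow_le_pow_left₀ (norm_nonneg _) (hQ _ (d.check u).2) 2
  have g1 := mul_le_mul_of_nonneg_right t1 (sq_nonneg ‖d.grad u‖)
  have g2 := mul_le_mul_of_nonneg_right t2 (sq_nonneg ‖d.der (d.check u)‖)
  have g3 := mul_le_mul_of_nonneg_left h3 t0.le
  have g4 := mul_le_mul_of_nonneg_left h4 t0.le
  linarith

/-! ### The state, the adjoint states and the derivative of the cost -/

theorem eq_of_A_eq {u u₁ : d.V} (h : c.A u = c.A u₁) : u = u₁ :=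
  have h0 : c.A (u - u₁) = 0 := by rw [map_sub, h, sub_self]
  sub_eq_zero.1 (c.eq_zero_of_A_apply_self (by rw [h0, zero_apply]))

theorem eq_of_adjointToDual_A_eq {p p₁ : d.V} (h : adjointToDual c.A p = adjointToDual c.A p₁) :
    p = p₁ := by
  have h0 : adjointToDual c.A (p - p₁) = 0 := by rw [map_sub, h, sub_self]
  exact sub_eq_zero.1 (c.eq_zero_of_A_apply_self (congrArg (fun f => f (p - p₁)) h0))

theorem isState_unique {φ : StrongDual ℝ d.Vhat} {ψ : d.Vhat} {u u₁ : d.V} {w w₁ : d.Vhat}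
    (h : c.IsState φ ψ u w) (h₁ : c.IsState φ ψ u₁ w₁) : u = u₁ ∧ w = w₁ := by
  refine ⟨c.eq_of_A_eq ?_, eq_of_isCoercive c.isCoercive_Ahat ?_⟩
  · have := h.1.trans h₁.1.symm
    simpa using this
  · have := h.2.trans h₁.2.symm
    simpa using this

theorem existsUnique_isAdjointStateHat (ψ w : d.Vhat) : ∃! p, c.IsAdjointStateHat ψ w p := by
  obtain ⟨p, hp⟩ := exists_eq_of_isCoercive c.isCoercive_flip_Ahat
    (adjoint d.ext (InnerProductSpace.toDualMap ℝ d.HGamma (d.ext w - d.ext ψ)))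
  exact ⟨p, hp, fun q hq => eq_of_isCoercive c.isCoercive_flip_Ahat (hq.trans hp.symm)⟩

theorem cost_nonneg (x : StrongDual ℝ d.Vhat × d.Vhat × d.V × d.Vhat) : 0 ≤ cost d x := by
  unfold cost
  positivity

theorem isAdjointState_iff (ψ : d.Vhat) (u p : d.V) : c.IsAdjointState ψ u p ↔
    ∀ v, c.A v p = ⟪d.trace u - d.ext ψ, d.trace v⟫ :=
  ⟨fun h v => DFunLike.congr_fun h v, fun h => ContinuousLinearMap.ext h⟩

theorem isAdjointStateHat_iff (ψ w p : d.Vhat) : c.IsAdjointStateHat ψ w p ↔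
    ∀ v, c.Ahat v p = ⟪d.ext w - d.ext ψ, d.ext v⟫ :=
  ⟨fun h v => DFunLike.congr_fun h v, fun h => ContinuousLinearMap.ext h⟩

theorem inner_gradPsi (ψ : d.Vhat) (u : d.V) (w : d.Vhat) (p : d.V) (phat v : d.Vhat) :
    ⟪c.gradPsi ψ u w p phat, v⟫ = c.C v p + c.Chat v phat -
      ⟪d.trace u + d.ext w - (2 : ℝ) • d.ext ψ, d.ext v⟫ :=
  InnerProductSpace.toDual_symm_apply

theorem apply_toDual_symm_gradPhi (p : d.V) (phat : d.Vhat) (φ : StrongDual ℝ d.Vhat) :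
    φ ((InnerProductSpace.toDual ℝ d.Vhat).symm (c.gradPhi p phat)) =
      c.B φ p - c.Bhat φ phat := by
  rw [gradPhi, LinearIsometryEquiv.symm_apply_apply, map_sub, adjointOfDual_spec,
    adjointOfDual_spec]

theorem controlForm_grad_apply (ψ : d.Vhat) (u : d.V) (w : d.Vhat) (p : d.V) (phat : d.Vhat)
    (h : StrongDual ℝ d.Vhat × d.Vhat × d.V × d.Vhat) :
    controlForm d (c.gradPhi p phat) (c.gradPsi ψ u w p phat) h =
      c.B h.1 p - c.Bhat h.1 phat + (c.C h.2.1 p + c.Chat h.2.1 phat -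
        ⟪d.trace u + d.ext w - (2 : ℝ) • d.ext ψ, d.ext h.2.1⟫) :=
  congrArg₂ (· + ·) (c.apply_toDual_symm_gradPhi p phat h.1) (c.inner_gradPsi ψ u w p phat h.2.1)

/-- The source `F` cancels in the difference of two states, so increments within the admissible set
satisfy the homogeneous linear equation. -/
theorem A_sub_eq {φ φ₁ : StrongDual ℝ d.Vhat} {ψ ψ₁ : d.Vhat} {u u₁ : d.V} {w w₁ : d.Vhat}
    (h : c.IsState φ ψ u w) (h₁ : c.IsState φ₁ ψ₁ u₁ w₁) :
    c.A (u₁ - u) = c.B (φ₁ - φ) + c.C (ψ₁ - ψ) := by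
  have := h₁.1.trans h.1.symm
  rw [map_sub, map_sub, map_sub]
  rw [← sub_eq_zero] at this ⊢
  rw [← this]
  abel

theorem Ahat_sub_eq {φ φ₁ : StrongDual ℝ d.Vhat} {ψ ψ₁ : d.Vhat} {u u₁ : d.V} {w w₁ : d.Vhat}
    (h : c.IsState φ ψ u w) (h₁ : c.IsState φ₁ ψ₁ u₁ w₁) :
    c.Ahat (w₁ - w) = c.Chat (ψ₁ - ψ) - c.Bhat (φ₁ - φ) := by
  have := h₁.2.trans h.2.symm
  rw [map_sub, map_sub, map_sub]
  rw [← sub_eq_zero] at this ⊢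
  rw [← this]
  abel

theorem inner_sub_add_inner_sub_HGamma (a b e a' b' e' : d.HGamma) :
    ⟪a - e, a' - e'⟫ + ⟪b - e, b' - e'⟫ =
      ⟪a - e, a'⟫ + ⟪b - e, b'⟫ - ⟪a + b - (2 : ℝ) • e, e'⟫ :=
  inner_sub_add_inner_sub a b e a' b' e'

/-- The adjoint equations are tested with the state increments `q, v`, and the homogeneous state
equations are evaluated at `p, p̂`. The values `A q p` and `Â v p̂` then occur in both and drop out,
leaving only the control increments. -/
theorem inner_add_inner_eq_controlForm {φ : StrongDual ℝ d.Vhat} {ψ η w v : d.Vhat} {u q p : d.V}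
    {phat : d.Vhat} (hp : c.IsAdjointState ψ u p) (hphat : c.IsAdjointStateHat ψ w phat)
    (h : c.A q = c.B φ + c.C η) (h' : c.Ahat v = c.Chat η - c.Bhat φ) :
    ⟪d.trace u - d.ext ψ, d.trace q - d.ext η⟫ + ⟪d.ext w - d.ext ψ, d.ext v - d.ext η⟫ =
      controlForm d (c.gradPhi p phat) (c.gradPsi ψ u w p phat) (φ, η, q, v) := by
  have h1 := (c.isAdjointState_iff ψ u p).1 hp q
  have h2 := (c.isAdjointStateHat_iff ψ w phat).1 hphat v
  have h3 : c.A q p = c.B φ p + c.C η p := DFunLike.congr_fun h p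
  have h4 : c.Ahat v phat = c.Chat η phat - c.Bhat φ phat := DFunLike.congr_fun h' phat
  exact eq_of_eq_add_sub (inner_sub_add_inner_sub_HGamma (d.trace u) (d.ext w) (d.ext ψ)
    (d.trace q) (d.ext v) (d.ext η)) h1 h2 h3 h4 (c.controlForm_grad_apply ψ u w p phat (φ, η, q, v))

theorem hasFDerivWithinAt_cost {φ : StrongDual ℝ d.Vhat} {ψ : d.Vhat} {u : d.V} {w : d.Vhat}
    {p : d.V} {phat : d.Vhat} (hs : c.IsState φ ψ u w) (hp : c.IsAdjointState ψ u p)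
    (hphat : c.IsAdjointStateHat ψ w phat) :
    HasFDerivWithinAt (cost d) (controlForm d (c.gradPhi p phat) (c.gradPsi ψ u w p phat))
      c.admissible (φ, ψ, u, w) := by
  have key := hasFDerivWithinAt_half_norm_sq_add (X₁ := StrongDual ℝ d.Vhat) d.ext d.trace d.ext
  refine key c.admissible (φ, ψ, u, w) _ fun y hy => ?_
  exact c.inner_add_inner_eq_controlForm hp hphat (c.A_sub_eq hs hy) (c.Ahat_sub_eq hs hy)

/-- There are controls whose state solves the coupled problem exactly. -/
theorem exists_cost_eq_zero : ∃ x ∈ c.admissible, cost d x = 0 := by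
  -- The sum of the bulk equation and of the line equation tested with `v̌`, for `û = ψ̂ = ǔ`: the
  -- reaction terms and the flux are gone.
  obtain ⟨u, hu⟩ := exists_eq_of_isCoercive c.isCoercive_coupledForm (c.F + c.G.comp d.check)
  -- The line equation now defines the flux, as the residual `G - (K̃|Σ| ǔ', ·')` in `V̂'`; the bulk
  -- equation follows by subtraction.
  obtain ⟨φ, hφ⟩ := d.exists_precomp_perimeterMul_eq (c.G - c.lineForm (d.check u))
  have hφ' : c.Bhat φ = c.G - c.lineForm (d.check u) := hφ
  refine ⟨(φ, d.check u, u, d.check u), ⟨ContinuousLinearMap.ext fun v => ?_, ?_⟩, ?_⟩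
  · have e1 : c.B φ v = c.Bhat φ (d.check v) := rfl
    have e2 := DFunLike.congr_fun hu v
    rw [coupledForm_apply, add_apply, ContinuousLinearMap.comp_apply] at e2
    change (c.A u - c.B φ - c.C (d.check u)) v = c.F v
    rw [sub_apply, sub_apply, A_eq_bulkForm_add, e1, hφ', sub_apply]
    linarith
  · change c.Ahat (d.check u) + c.Bhat φ - c.Chat (d.check u) = c.G
    rw [Ahat_eq_lineForm_add, hφ']
    abel
  -- The trace of `u` is by definition the extension of `ǔ`.
  · have e : d.trace u - d.ext (d.check u) = 0 := sub_self (d.ext (d.check u))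
    change 1 / 2 * (‖d.trace u - d.ext (d.check u)‖ ^ 2 +
      ‖d.ext (d.check u) - d.ext (d.check u)‖ ^ 2) = 0
    rw [e, sub_self, norm_zero]
    norm_num

/-! ### Vanishing residuals and the optimality conditions -/

theorem residuals_eq_zero_of_cost_eq_zero {φ : StrongDual ℝ d.Vhat} {ψ : d.Vhat} {u : d.V}
    {w : d.Vhat} (h : cost d (φ, ψ, u, w) = 0) :
    d.trace u - d.ext ψ = 0 ∧ d.ext w - d.ext ψ = 0 := by
  change 1 / 2 * (‖d.trace u - d.ext ψ‖ ^ 2 + ‖d.ext w - d.ext ψ‖ ^ 2) = 0 at h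
  have h1 := sq_nonneg ‖d.trace u - d.ext ψ‖
  have h2 := sq_nonneg ‖d.ext w - d.ext ψ‖
  constructor
  · rw [← norm_eq_zero]
    exact pow_eq_zero_iff two_ne_zero |>.1 (by linarith)
  · rw [← norm_eq_zero]
    exact pow_eq_zero_iff two_ne_zero |>.1 (by linarith)

/-- With zero residual the right-hand side is zero, so `0` solves the equation and uniqueness
excludes anything else. Existence of `p`, for which coercivity of `A` is not at hand, is thus
immediate at an optimum. -/
theorem isAdjointState_iff_eq_zero {ψ : d.Vhat} {u : d.V} (h : d.trace u - d.ext ψ = 0) (p : d.V) :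
    c.IsAdjointState ψ u p ↔ p = 0 := by
  have h0 : c.IsAdjointState ψ u 0 :=
    (c.isAdjointState_iff ψ u 0).2 fun v => by rw [h, inner_zero_left, map_zero]
  exact ⟨fun hp => c.eq_of_adjointToDual_A_eq (hp.trans h0.symm), fun hp => hp ▸ h0⟩

theorem isAdjointStateHat_iff_eq_zero {ψ w : d.Vhat} (h : d.ext w - d.ext ψ = 0) (p : d.Vhat) :
    c.IsAdjointStateHat ψ w p ↔ p = 0 := by
  have h0 : c.IsAdjointStateHat ψ w 0 :=
    (c.isAdjointStateHat_iff ψ w 0).2 fun v => by rw [h, inner_zero_left, map_zero]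
  exact ⟨fun hp => eq_of_isCoercive c.isCoercive_flip_Ahat (hp.trans h0.symm), fun hp => hp ▸ h0⟩

/-- Optimality is used only through the value of the cost, not through its derivative: the minimum
is zero, so the residuals, the adjoint states and both gradient expressions vanish one after the
other. -/
theorem optimality {φ : StrongDual ℝ d.Vhat} {ψ : d.Vhat} {u : d.V} {w : d.Vhat}
    (hmin : IsMinOn (cost d) c.admissible (φ, ψ, u, w)) :
    (∃! p, c.IsAdjointState ψ u p) ∧ (∃! phat, c.IsAdjointStateHat ψ w phat) ∧
      ∀ p phat, c.IsAdjointState ψ u p → c.IsAdjointStateHat ψ w phat →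
        c.gradPhi p phat = 0 ∧ c.gradPsi ψ u w p phat = 0 := by
  obtain ⟨x, hx, hx0⟩ := c.exists_cost_eq_zero
  have h0 : cost d (φ, ψ, u, w) = 0 := le_antisymm (hx0 ▸ hmin hx) (cost_nonneg _)
  obtain ⟨h1, h2⟩ := residuals_eq_zero_of_cost_eq_zero h0
  refine ⟨⟨0, (c.isAdjointState_iff_eq_zero h1 0).2 rfl,
    fun p => (c.isAdjointState_iff_eq_zero h1 p).1⟩, c.existsUnique_isAdjointStateHat ψ w,
    fun p phat hp hphat => ?_⟩
  obtain rfl := (c.isAdjointState_iff_eq_zero h1 p).1 hp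
  obtain rfl := (c.isAdjointStateHat_iff_eq_zero h2 phat).1 hphat
  -- The last term of `gradPsi` is governed by the sum of the two residuals.
  have h3 : d.trace u + d.ext w - (2 : ℝ) • d.ext ψ = 0 :=
    (add_sub_two_smul _ _ _).trans ((congrArg₂ (· + ·) h1 h2).trans (add_zero 0))
  constructor
  · rw [gradPhi, adjointOfDual_zero, adjointOfDual_zero, sub_self]
    exact LinearIsometryEquiv.map_zero _
  · refine ext_inner_right ℝ fun v => ?_
    rw [inner_gradPsi, h3, inner_zero_left, inner_zero_left, map_zero, map_zero, add_zero, sub_zero]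

end Coefficients

end Coupled3D1D

end

theorem proposition1 (d : Coupled3D1D.Domain) (c : Coupled3D1D.Coefficients d) :
    -- the state, if it exists, is determined by the controls
    (∀ φ ψ u uhat u₁ uhat₁, c.IsState φ ψ u uhat → c.IsState φ ψ u₁ uhat₁ →
      u = u₁ ∧ uhat = uhat₁) ∧
    -- the adjoint state `p`, if it exists, is unique; the adjoint state `p̂` exists and is unique
    (∀ ψ u p p₁, c.IsAdjointState ψ u p → c.IsAdjointState ψ u p₁ → p = p₁) ∧
    (∀ ψ uhat, ∃! phat, c.IsAdjointStateHat ψ uhat phat) ∧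
    -- the derivative of the cost with respect to the controls, along the state equation
    (∀ φ ψ u uhat p phat, c.IsState φ ψ u uhat →
      c.IsAdjointState ψ u p → c.IsAdjointStateHat ψ uhat phat →
        HasFDerivWithinAt (Coupled3D1D.cost d)
          (Coupled3D1D.controlForm d (c.gradPhi p phat) (c.gradPsi ψ u uhat p phat))
          c.admissible (φ, ψ, u, uhat)) ∧
    -- there is an optimal control
    (∃ x ∈ c.admissible, IsMinOn (Coupled3D1D.cost d) c.admissible x) ∧
    -- every optimal control satisfies the optimality conditions
    (∀ φ ψ u uhat, c.IsState φ ψ u uhat →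
      IsMinOn (Coupled3D1D.cost d) c.admissible (φ, ψ, u, uhat) →
        (∃! p, c.IsAdjointState ψ u p) ∧
        (∃! phat, c.IsAdjointStateHat ψ uhat phat) ∧
        ∀ p phat, c.IsAdjointState ψ u p → c.IsAdjointStateHat ψ uhat phat →
          c.gradPhi p phat = 0 ∧ c.gradPsi ψ u uhat p phat = 0) :=
  ⟨fun _ _ _ _ _ _ h h₁ => c.isState_unique h h₁,
    fun _ _ _ _ h h₁ => c.eq_of_adjointToDual_A_eq (h.trans h₁.symm),
    c.existsUnique_isAdjointStateHat,
    fun _ _ _ _ _ _ hs hp hphat => c.hasFDerivWithinAt_cost hs hp hphat,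
    -- A point of cost zero is a minimizer because the cost is nonnegative; no weak compactness or
    -- lower semicontinuity is involved.
    (c.exists_cost_eq_zero).imp fun _ hx => ⟨hx.1, fun _ _ => by
      rw [mem_ofPred_eq, hx.2]
      exact Coupled3D1D.Coefficients.cost_nonneg _⟩,
    fun _ _ _ _ _ hmin => c.optimality hmin⟩
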